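/- Theorem (Rado's theorem). Let $\Omega\subset\mathbb R^2$ be a convex set and let $\sigma\subset\mathbb R^3$ be a simple closed curve which is graphical over $\partial\Omega$, i.e. $\sigma=\{(x,h(x)) : x\in\partial\Omega\}$ for some function $h:\partial\Omega\to\mathbb R$. A minimal disk with boundary $\sigma$ means the image $\Sigma=F(\overline D)$ of the closed unit disk $\overline D\subset\mathbb R^2$ under a continuous map $F:\overline D\to\mathbb R^3$ which maps $\partial D$ bijectively onto $\sigma$ and whose restriction to the open disk $D$ is a $C^\infty$ immersion with mean curvature vector identically zero ($F$ is not assumed to be conformal, or injective in the interior). Then: (1) every minimal disk $\Sigma=F(\overline D)$ with boundary $\sigma$ is embedded and is a graph over $\Omega$: $F$ is injective on $\overline D$, and there is a function $u:\overline\Omega\to\mathbb R$, continuous on $\overline\Omega$ and $C^\infty$ in the interior of $\Omega$, such that $F(\overline D)=\{(x,u(x)) : x\in\overline\Omega\}$ and $F(D)=\{(x,u(x)) : x\in\operatorname{int}\Omega\}$; (2) the minimal disk with boundary $\sigma$ is unique: any two minimal disks with boundary $\sigma$ coincide as subsets of $\mathbb R^3$. -/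

import Mathlib

open scoped ContDiff

noncomputable section

/-- The Euclidean plane `ℝ²`. -/
abbrev Plane : Type := EuclideanSpace ℝ (Fin 2)

/-- Euclidean space `ℝ³`. -/
abbrev Space : Type := EuclideanSpace ℝ (Fin 3)

/-- The orthogonal projection `(x₁, x₂, x₃) ↦ (x₁, x₂)`. -/
def horizontal (p : Space) : Plane := !₂[p 0, p 1]

/-- The graph `{(x, u x) | x ∈ S}` in `ℝ³` of a function `u` over a set `S` in the plane. -/
def graphOver (u : Plane → ℝ) (S : Set Plane) : Set Space :=
  {p | horizontal p ∈ S ∧ p 2 = u (horizontal p)}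

/-- A subset of `ℝ³` is graphical over `S` if it is the graph of a real function on `S`.
(A compact graph is the graph of a continuous function, so continuity is not required here.) -/
def IsGraphicalOver (s : Set Space) (S : Set Plane) : Prop :=
  ∃ h : Plane → ℝ, s = graphOver h S

/-- A simple closed curve: the image of an injective continuous map from the circle. -/
def IsSimpleClosedCurve (s : Set Space) : Prop :=
  ∃ γ : Circle → Space, Continuous γ ∧ Function.Injective γ ∧ Set.range γ = s

/-- The partial derivative `∂ᵢ F`. -/
def partialDeriv (i : Fin 2) (F : Plane → Space) (z : Plane) : Space :=
  fderiv ℝ F z (EuclideanSpace.single i 1)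

/-- The first fundamental form `gᵢⱼ = ⟨∂ᵢ F, ∂ⱼ F⟩`. -/
def firstFundamentalForm (F : Plane → Space) (z : Plane) : Matrix (Fin 2) (Fin 2) ℝ :=
  Matrix.of fun i j => inner ℝ (partialDeriv i F z) (partialDeriv j F z)

/-- The tangent plane at the parameter `z`: the span of the partial derivatives of `F`. -/
def tangentPlane (F : Plane → Space) (z : Plane) : Submodule ℝ Space :=
  LinearMap.range (fderiv ℝ F z).toLinearMap

/-- The vector valued second fundamental form `Aᵢⱼ`, the normal part of `∂ᵢ ∂ⱼ F`. -/
def secondFundamentalForm (F : Plane → Space) (z : Plane) (i j : Fin 2) : Space :=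
  (tangentPlane F z)ᗮ.starProjection (partialDeriv i (partialDeriv j F) z)

/-- The mean curvature vector `∑ᵢⱼ gⁱʲ Aᵢⱼ` (the trace of the second fundamental form). -/
def meanCurvatureVector (F : Plane → Space) (z : Plane) : Space :=
  ∑ i, ∑ j, (firstFundamentalForm F z)⁻¹ i j • secondFundamentalForm F z i j

/-- `F` parametrizes a minimal disk with boundary `s`: it is continuous on the closed unit disk,
it maps the boundary circle bijectively onto `s`, and on the open unit disk it is a smooth
immersion with vanishing mean curvature. Neither injectivity of `F` in the interior nor
conformality is required. The disk itself is the set `F '' closedBall 0 1`. -/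
structure IsMinimalDisk (F : Plane → Space) (s : Set Space) : Prop where
  continuousOn : ContinuousOn F (Metric.closedBall 0 1)
  boundary : Set.BijOn F (Metric.sphere 0 1) s
  smooth : ContDiffOn ℝ ∞ F (Metric.ball 0 1)
  immersion : ∀ z ∈ Metric.ball (0 : Plane) 1, Function.Injective (fderiv ℝ F z)
  minimal : ∀ z ∈ Metric.ball (0 : Plane) 1, meanCurvatureVector F z = 0

end

/-! The projection of the disk to the plane is shown to be a homeomorphism onto the closure of Ω.
Everything rests on Hopf's maximum principle (`strong_maximum_principle`), applied to differences
and to derivatives of solutions of the minimal surface equation.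

A linear function with an interior maximum on a minimal disk is constant. Using horizontal linear
functions and a separating line, `IsMinimalDisk.horizontal_mem_interior` places the open disk over
the interior of Ω.

Next, take two minimal disks with the same boundary and translate one vertically by the largest gap
between them. Contact then occurs only at interior parameters, and the touching principle makes the
contact set open as well as compact. A nonempty bounded set cannot be clopen in the plane, so no gap
exists (`IsMinimalDisk.height_le`). This gives uniqueness; for a disk compared with itself it says
that the horizontal projection of a point determines its height.

Such a surface has no vertical tangent plane (`normal_vertical_ne_zero`). Otherwise, write it near
the point as a graph over a vertical plane. Injectivity along vertical chords gives the vertical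
derivative a sign, and that derivative vanishes at the point. The maximum principle for the
linearised equation makes it vanish identically, so the chords are not injective after all. No
analysis of nodal lines is needed.

Hence the projection is a local homeomorphism on the open disk. It is a covering over the interior
of Ω, which is contractible, so it is injective (`injOn_ball_of_isLocalHomeomorphOn`). Surjectivity
is a connectedness argument, and the local inverses give the smoothness of the graph function. -/

section RadoTheorem

open Metric Filter Topology

/-! ### Calculus of partial derivatives on the plane. -/

/-- The partial derivative `∂ᵢ f` of a real function on the plane. -/
noncomputable def pd (i : Fin 2) (f : Plane → ℝ) (z : Plane) : ℝ :=
  fderiv ℝ f z (EuclideanSpace.single i 1)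

lemma plane_eq_sum (h : Plane) :
    h = h 0 • EuclideanSpace.single (0 : Fin 2) (1 : ℝ)
      + h 1 • EuclideanSpace.single (1 : Fin 2) (1 : ℝ) := by
  ext i; fin_cases i <;> simp

lemma fderiv_apply_eq_pd (f : Plane → ℝ) (z h : Plane) :
    fderiv ℝ f z h = h 0 * pd 0 f z + h 1 * pd 1 f z := by
  conv_lhs => rw [plane_eq_sum h]
  simp [pd]

lemma two_le_smooth : (2 : WithTop ℕ∞) ≤ ∞ :=
  WithTop.coe_le_coe.2 (le_top : ((2 : ℕ) : ℕ∞) ≤ ⊤)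

lemma ContDiffAt.pd {f : Plane → ℝ} {z : Plane} (hf : ContDiffAt ℝ ∞ f z) (i : Fin 2) :
    ContDiffAt ℝ ∞ (pd i f) z :=
  (hf.fderiv_right (m := ∞) (by simp)).clm_apply contDiffAt_const

lemma ContDiffAt.diffAt {f : Plane → ℝ} {z : Plane} (hf : ContDiffAt ℝ ∞ f z) :
    DifferentiableAt ℝ f z := hf.differentiableAt (by simp)

lemma pd_congr {f g : Plane → ℝ} {z : Plane} (h : f =ᶠ[𝓝 z] g) (i : Fin 2) :
    pd i f z = pd i g z := by
  simp [pd, h.fderiv_eq]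

lemma ContDiffAt.eventually_contDiffAt {f : Plane → ℝ} {z : Plane} (hf : ContDiffAt ℝ ∞ f z) :
    ∀ᶠ y in 𝓝 z, ContDiffAt ℝ 2 f y :=
  (hf.of_le two_le_smooth).eventually (by simp)

lemma pd_comm {f : Plane → ℝ} {z : Plane} (hf : ContDiffAt ℝ ∞ f z) (i j : Fin 2) :
    pd i (pd j f) z = pd j (pd i f) z := by
  have hd : DifferentiableAt ℝ (fderiv ℝ f) z :=
    (hf.fderiv_right (m := ∞) (by simp)).differentiableAt (by simp)
  have key : ∀ a b : Fin 2, pd a (pd b f) z =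
      fderiv ℝ (fderiv ℝ f) z (EuclideanSpace.single a 1) (EuclideanSpace.single b 1) := by
    intro a b
    change fderiv ℝ (fun y => fderiv ℝ f y (EuclideanSpace.single b 1)) z _ = _
    rw [fderiv_clm_apply hd (differentiableAt_const _)]
    simp
  rw [key, key]
  exact (hf.isSymmSndFDerivAt (by simpa using two_le_smooth)).eq _ _

lemma pd_add {f g : Plane → ℝ} {z : Plane} (hf : DifferentiableAt ℝ f z)
    (hg : DifferentiableAt ℝ g z) (i : Fin 2) :
    pd i (fun y => f y + g y) z = pd i f z + pd i g z := by
  simp [pd, fderiv_fun_add hf hg]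

lemma pd_sub {f g : Plane → ℝ} {z : Plane} (hf : DifferentiableAt ℝ f z)
    (hg : DifferentiableAt ℝ g z) (i : Fin 2) :
    pd i (fun y => f y - g y) z = pd i f z - pd i g z := by
  simp [pd, fderiv_fun_sub hf hg]

lemma pd_neg {f : Plane → ℝ} {z : Plane} (i : Fin 2) :
    pd i (fun y => - f y) z = - pd i f z := by
  simp [pd, fderiv_fun_neg]

lemma pd_mul {f g : Plane → ℝ} {z : Plane} (hf : DifferentiableAt ℝ f z)
    (hg : DifferentiableAt ℝ g z) (i : Fin 2) :
    pd i (fun y => f y * g y) z = pd i f z * g z + f z * pd i g z := by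
  simp [pd, fderiv_fun_mul hf hg]; ring

lemma pd_const (c : ℝ) (z : Plane) (i : Fin 2) : pd i (fun _ => c) z = 0 := by
  simp [pd]

lemma pd_exp {f : Plane → ℝ} {z : Plane} (hf : DifferentiableAt ℝ f z) (i : Fin 2) :
    pd i (fun y => Real.exp (f y)) z = Real.exp (f z) * pd i f z := by
  simp [pd, fderiv_exp hf]

lemma pd_coord (j : Fin 2) (z : Plane) (i : Fin 2) :
    pd i (fun y => y j) z = if j = i then 1 else 0 := by
  have : HasFDerivAt (fun y : Plane => y j) (EuclideanSpace.proj j : Plane →L[ℝ] ℝ) z :=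
    (EuclideanSpace.proj j : Plane →L[ℝ] ℝ).hasFDerivAt
  simp [pd, this.fderiv]

/-! ### Linear elliptic operators and Hopf's maximum principle. -/

/-- The second order linear operator with leading coefficients `a₁₁, a₁₂, a₂₂` and first order
coefficients `b₁, b₂`. -/
noncomputable def ellOp (a₁ a₂ a₃ b₁ b₂ : Plane → ℝ) (w : Plane → ℝ) (z : Plane) : ℝ :=
  a₁ z * pd 0 (pd 0 w) z + a₂ z * (pd 0 (pd 1 w) z + pd 1 (pd 0 w) z) + a₃ z * pd 1 (pd 1 w) z
    + b₁ z * pd 0 w z + b₂ z * pd 1 w z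

lemma pd_eq_zero_of_isLocalMax {f : Plane → ℝ} {z : Plane} (h : IsLocalMax f z) (i : Fin 2) :
    pd i f z = 0 := by
  simp [pd, h.fderiv_eq_zero]

/-- A positive second derivative would make the point a local minimum too. The function would then
be locally constant, with second derivative zero. -/
lemma IsLocalMax.second_deriv_nonpos {g : ℝ → ℝ} {t : ℝ} (h : IsLocalMax g t)
    (hc : ContinuousAt g t) : deriv (deriv g) t ≤ 0 := by
  by_contra! hpos
  have hmin := isLocalMin_of_deriv_deriv_pos hpos h.deriv_eq_zero hc
  have hconst : g =ᶠ[𝓝 t] fun _ => g t := by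
    filter_upwards [h, hmin] with y h1 h2 using le_antisymm h1 h2
  have : deriv (deriv g) t = 0 := by
    have h1 : deriv g =ᶠ[𝓝 t] fun _ => 0 := by
      filter_upwards [hconst.eventuallyEq_nhds] with y hy
      rw [hy.deriv_eq]; simp
    rw [h1.deriv_eq]; simp
  linarith

lemma hessian_nonpos_of_isLocalMax {f : Plane → ℝ} {z : Plane} (hf : ContDiffAt ℝ ∞ f z)
    (h : IsLocalMax f z) (ξ : Plane) :
    ξ 0 * (ξ 0 * pd 0 (pd 0 f) z + ξ 1 * pd 1 (pd 0 f) z)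
      + ξ 1 * (ξ 0 * pd 0 (pd 1 f) z + ξ 1 * pd 1 (pd 1 f) z) ≤ 0 := by
  have hline : ∀ t : ℝ, HasDerivAt (fun t : ℝ => z + t • ξ) ξ t := fun t => by
    simpa using ((hasDerivAt_id t).smul_const ξ).const_add z
  have h0 : z + (0 : ℝ) • ξ = z := by simp
  have htend : Tendsto (fun t : ℝ => z + t • ξ) (𝓝 0) (𝓝 z) := by
    simpa using (hline 0).continuousAt.tendsto
  set g : ℝ → ℝ := fun t => f (z + t • ξ) with hg
  have hmax : IsLocalMax g 0 := by
    have := htend.eventually h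
    filter_upwards [this] with t ht
    simpa [hg] using ht
  have hcont : ContinuousAt g 0 := by
    refine ContinuousAt.comp (f := fun t : ℝ => z + t • ξ) ?_ (hline 0).continuousAt
    rw [h0]; exact hf.continuousAt
  have hd1 : deriv g =ᶠ[𝓝 0] fun t => ξ 0 * pd 0 f (z + t • ξ) + ξ 1 * pd 1 f (z + t • ξ) := by
    filter_upwards [htend.eventually hf.eventually_contDiffAt] with t ht
    rw [← fderiv_apply_eq_pd]
    exact ((ht.differentiableAt (by simp)).hasFDerivAt.comp_hasDerivAt t (hline t)).deriv
  have hd2 : ∀ i, HasDerivAt (fun t : ℝ => pd i f (z + t • ξ))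
      (ξ 0 * pd 0 (pd i f) z + ξ 1 * pd 1 (pd i f) z) 0 := by
    intro i
    rw [← fderiv_apply_eq_pd]
    have h1 : HasFDerivAt (pd i f) (fderiv ℝ (pd i f) z) (z + (0 : ℝ) • ξ) := by
      rw [h0]; exact (hf.pd i).diffAt.hasFDerivAt
    exact h1.comp_hasDerivAt 0 (hline 0)
  have := hmax.second_deriv_nonpos hcont
  rw [hd1.deriv_eq, (((hd2 0).const_mul (ξ 0)).fun_add ((hd2 1).const_mul (ξ 1))).deriv] at this
  exact this

/-- At an interior maximum an elliptic operator is nonpositive. -/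
lemma ellOp_nonpos_of_isLocalMax {a₁ a₂ a₃ b₁ b₂ w : Plane → ℝ} {z : Plane}
    (hw : ContDiffAt ℝ ∞ w z) (h : IsLocalMax w z) (ha : 0 < a₁ z)
    (hdet : 0 < a₁ z * a₃ z - a₂ z ^ 2) : ellOp a₁ a₂ a₃ b₁ b₂ w z ≤ 0 := by
  -- Completing the square: `a₁` times the principal part is the Hessian form at `(a₁, a₂)` plus the
  -- determinant times the form at `(0, 1)`.
  have h1 := hessian_nonpos_of_isLocalMax hw h !₂[a₁ z, a₂ z]
  have h2 := hessian_nonpos_of_isLocalMax hw h !₂[0, 1]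
  simp only [ellOp, pd_eq_zero_of_isLocalMax h, mul_zero, add_zero]
  simp only [Matrix.cons_val_zero, Matrix.cons_val_one] at h1 h2
  refine nonpos_of_mul_nonpos_right (a := a₁ z) ?_ ha
  nlinarith

lemma quadForm_pos {a b c x y : ℝ} (ha : 0 < a) (hdet : 0 < a * c - b ^ 2)
    (hxy : x ≠ 0 ∨ y ≠ 0) : 0 < a * x ^ 2 + 2 * b * x * y + c * y ^ 2 := by
  refine pos_of_mul_pos_right (a := a) ?_ ha.le
  have : a * (a * x ^ 2 + 2 * b * x * y + c * y ^ 2)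
      = (a * x + b * y) ^ 2 + (a * c - b ^ 2) * y ^ 2 := by ring
  rw [this]
  by_cases hy : y = 0
  · subst hy
    have hx : x ≠ 0 := by simpa using hxy
    have : a * x ≠ 0 := mul_ne_zero ha.ne' hx
    simp; positivity
  · positivity

/-- The Gaussian barrier centred at `c`. -/
noncomputable def gaussBarrier (α : ℝ) (c : Plane) (x : Plane) : ℝ :=
  Real.exp (-α * ((x 0 - c 0) * (x 0 - c 0) + (x 1 - c 1) * (x 1 - c 1)))

lemma contDiff_coord (j : Fin 2) : ContDiff ℝ ∞ (fun y : Plane => y j) :=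
  (EuclideanSpace.proj j : Plane →L[ℝ] ℝ).contDiff

lemma contDiff_gaussBarrier (α : ℝ) (c : Plane) : ContDiff ℝ ∞ (gaussBarrier α c) := by
  unfold gaussBarrier
  have h0 := contDiff_coord 0
  have h1 := contDiff_coord 1
  fun_prop

lemma pd_gaussBarrier (α : ℝ) (c : Plane) (i : Fin 2) :
    pd i (gaussBarrier α c) = fun x => gaussBarrier α c x * (-2 * α * (x i - c i)) := by
  funext x
  have hd : ∀ j, DifferentiableAt ℝ (fun y : Plane => y j - c j) x := fun j =>
    (contDiff_coord j).contDiffAt.diffAt.fun_sub (differentiableAt_const _)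
  have hc : ∀ j, pd i (fun y => y j - c j) x = if j = i then 1 else 0 := fun j => by
    rw [pd_sub (contDiff_coord j).contDiffAt.diffAt (differentiableAt_const _), pd_const, pd_coord,
      sub_zero]
  unfold gaussBarrier
  rw [pd_exp ((differentiableAt_const _).fun_mul (((hd 0).fun_mul (hd 0)).fun_add ((hd 1).fun_mul (hd 1)))),
    pd_mul (differentiableAt_const _) (((hd 0).fun_mul (hd 0)).fun_add ((hd 1).fun_mul (hd 1))), pd_const,
    pd_add ((hd 0).fun_mul (hd 0)) ((hd 1).fun_mul (hd 1)), pd_mul (hd 0) (hd 0), pd_mul (hd 1) (hd 1),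
    hc, hc]
  fin_cases i <;> simp <;> ring

lemma pd_pd_gaussBarrier (α : ℝ) (c : Plane) (i j : Fin 2) (x : Plane) :
    pd i (pd j (gaussBarrier α c)) x = gaussBarrier α c x *
      (4 * α ^ 2 * (x i - c i) * (x j - c j) - if j = i then 2 * α else 0) := by
  have hd : DifferentiableAt ℝ (fun y : Plane => y j - c j) x :=
    (contDiff_coord j).contDiffAt.diffAt.fun_sub (differentiableAt_const _)
  have hc : pd i (fun y => y j - c j) x = if j = i then 1 else 0 := by
    rw [pd_sub (contDiff_coord j).contDiffAt.diffAt (differentiableAt_const _), pd_const, pd_coord,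
      sub_zero]
  rw [pd_gaussBarrier α c j, pd_mul (contDiff_gaussBarrier α c).contDiffAt.diffAt
    ((differentiableAt_const _).fun_mul hd), pd_mul (differentiableAt_const _) hd, pd_const, hc,
    pd_gaussBarrier α c i]
  split_ifs <;> ring

/-- Exhibits the competition in α: the quadratic form carries an extra factor α, so wherever it is
positive it wins for large α. -/
lemma ellOp_gaussBarrier (a₁ a₂ a₃ b₁ b₂ : Plane → ℝ) (α : ℝ) (c x : Plane) :
    ellOp a₁ a₂ a₃ b₁ b₂ (gaussBarrier α c) x = 2 * α * gaussBarrier α c x *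
      (2 * α * (a₁ x * (x 0 - c 0) ^ 2 + 2 * a₂ x * (x 0 - c 0) * (x 1 - c 1)
        + a₃ x * (x 1 - c 1) ^ 2)
      - (a₁ x + a₃ x + b₁ x * (x 0 - c 0) + b₂ x * (x 1 - c 1))) := by
  simp only [ellOp, pd_pd_gaussBarrier]
  simp only [pd_gaussBarrier, if_pos, one_ne_zero, zero_ne_one, if_false]
  ring

/-- The combination `f + ε (g - c)` is the shape of Hopf's comparison function; the choices `ε = -1`
and `ε = -2` also give differences and negation. -/
lemma ellOp_add_mul {a₁ a₂ a₃ b₁ b₂ f g : Plane → ℝ} {z : Plane} (hf : ContDiffAt ℝ ∞ f z)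
    (hg : ContDiffAt ℝ ∞ g z) (ε c : ℝ) :
    ellOp a₁ a₂ a₃ b₁ b₂ (fun x => f x + ε * (g x - c)) z
      = ellOp a₁ a₂ a₃ b₁ b₂ f z + ε * ellOp a₁ a₂ a₃ b₁ b₂ g z := by
  have h1 : ∀ {f g : Plane → ℝ} {z : Plane} (c : ℝ) (i : Fin 2), DifferentiableAt ℝ f z →
      DifferentiableAt ℝ g z →
      pd i (fun x => f x + ε * (g x - c)) z = pd i f z + ε * (pd i g z - 0) := by
    intro f g z c i hf hg
    rw [pd_add hf ((differentiableAt_const _).fun_mul (hg.fun_sub (differentiableAt_const _))),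
      pd_mul (differentiableAt_const _) (hg.fun_sub (differentiableAt_const _)),
      pd_sub hg (differentiableAt_const _), pd_const, pd_const]
    ring
  have h2 : ∀ i, pd i (fun x => f x + ε * (g x - c)) =ᶠ[𝓝 z]
      fun x => pd i f x + ε * (pd i g x - 0) := by
    intro i
    filter_upwards [hf.eventually_contDiffAt, hg.eventually_contDiffAt] with y hy1 hy2
    exact h1 c i (hy1.differentiableAt (by simp)) (hy2.differentiableAt (by simp))
  have h3 : ∀ i j, pd j (pd i (fun x => f x + ε * (g x - c))) z
      = pd j (pd i f) z + ε * (pd j (pd i g) z - 0) := fun i j => by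
    rw [pd_congr (h2 i), h1 0 j (hf.pd i).diffAt (hg.pd i).diffAt]
  simp only [ellOp, h3, h1 c _ hf.diffAt hg.diffAt]
  ring

lemma dist_sq_plane (x c : Plane) :
    dist x c ^ 2 = (x 0 - c 0) * (x 0 - c 0) + (x 1 - c 1) * (x 1 - c 1) := by
  rw [EuclideanSpace.dist_eq, Real.sq_sqrt (Finset.sum_nonneg fun _ _ => sq_nonneg _),
    Fin.sum_univ_two, Real.dist_eq, Real.dist_eq, sq_abs, sq_abs]
  ring

lemma gaussBarrier_eq (α : ℝ) (c x : Plane) :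
    gaussBarrier α c x = Real.exp (-α * dist x c ^ 2) := by
  rw [dist_sq_plane]; rfl

/-- On a compact set away from its centre the Gaussian barrier is a strict subsolution once it is
steep enough. -/
lemma exists_ellOp_gaussBarrier_pos {a₁ a₂ a₃ b₁ b₂ : Plane → ℝ} {K : Set Plane}
    (hK : IsCompact K) {c : Plane} (hc : c ∉ K)
    (ha₁ : ContinuousOn a₁ K) (ha₂ : ContinuousOn a₂ K) (ha₃ : ContinuousOn a₃ K)
    (hb₁ : ContinuousOn b₁ K) (hb₂ : ContinuousOn b₂ K) (hpos : ∀ z ∈ K, 0 < a₁ z)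
    (hdet : ∀ z ∈ K, 0 < a₁ z * a₃ z - a₂ z ^ 2) :
    ∃ α > 0, ∀ z ∈ K, 0 < ellOp a₁ a₂ a₃ b₁ b₂ (gaussBarrier α c) z := by
  set Q : Plane → ℝ := fun x => a₁ x * (x 0 - c 0) ^ 2 + 2 * a₂ x * (x 0 - c 0) * (x 1 - c 1)
        + a₃ x * (x 1 - c 1) ^ 2 with hQ
  set B : Plane → ℝ := fun x => a₁ x + a₃ x + b₁ x * (x 0 - c 0) + b₂ x * (x 1 - c 1) with hB
  have hQpos : ∀ z ∈ K, 0 < Q z := by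
    intro z hz
    refine quadForm_pos (hpos z hz) (hdet z hz) ?_
    by_contra! h
    apply hc
    have : z = c := by
      ext i; fin_cases i
      · exact sub_eq_zero.1 h.1
      · exact sub_eq_zero.1 h.2
    rwa [← this]
  have h0 : ContinuousOn (fun x : Plane => x 0 - c 0) K :=
    ((contDiff_coord 0).continuous.sub continuous_const).continuousOn
  have h1 : ContinuousOn (fun x : Plane => x 1 - c 1) K :=
    ((contDiff_coord 1).continuous.sub continuous_const).continuousOn
  have hcont : ContinuousOn (fun x => B x / Q x) K := by
    refine ContinuousOn.div ?_ ?_ fun z hz => (hQpos z hz).ne'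
    · fun_prop
    · fun_prop
  obtain ⟨M, hM⟩ := hK.bddAbove_image hcont
  -- `M` bounds `B / Q`, so any positive α exceeding `M` gives `2 α Q > B`.
  refine ⟨max M 0 + 1, by positivity, fun z hz => ?_⟩
  rw [ellOp_gaussBarrier]
  have hα : 0 < max M 0 + 1 := by positivity
  have hg : 0 < gaussBarrier (max M 0 + 1) c z := Real.exp_pos _
  refine mul_pos (by positivity) ?_
  have h2 : B z / Q z ≤ M := hM ⟨z, hz, rfl⟩
  rw [div_le_iff₀ (hQpos z hz)] at h2
  have h3 := hQpos z hz
  have : M * Q z ≤ max M 0 * Q z := mul_le_mul_of_nonneg_right (le_max_left _ _) h3.le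
  have h4 : 0 ≤ max M 0 * Q z := mul_nonneg (le_max_right _ _) h3.le
  change 0 < 2 * (max M 0 + 1) * Q z - B z
  nlinarith

/-- Shows that the disk with diameter from `q` to `y` lies inside the open disk about `q` through
`y`, except at `y` itself. -/
lemma parallelogram_plane (x q y : Plane) :
    dist x q ^ 2 + dist x y ^ 2
      = 2 * dist x (midpoint ℝ q y) ^ 2 + dist q y ^ 2 / 2 := by
  have h : ∀ i, (midpoint ℝ q y) i = (q i + y i) / 2 := fun i => by
    simp [midpoint_eq_smul_add]; ring
  simp only [dist_sq_plane, h]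
  ring

/-- Hopf's boundary lemma: a nonpositive subsolution cannot vanish at an interior point of its
domain which lies on the boundary of a disk where it is negative. -/
lemma subsolution_not_touch {V : Set Plane} (hV : IsOpen V) {a₁ a₂ a₃ b₁ b₂ w : Plane → ℝ}
    (ha₁ : ContinuousOn a₁ V) (ha₂ : ContinuousOn a₂ V) (ha₃ : ContinuousOn a₃ V)
    (hb₁ : ContinuousOn b₁ V) (hb₂ : ContinuousOn b₂ V) (hpos : ∀ z ∈ V, 0 < a₁ z)
    (hdet : ∀ z ∈ V, 0 < a₁ z * a₃ z - a₂ z ^ 2)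
    (hw : ∀ z ∈ V, ContDiffAt ℝ ∞ w z) (hle : ∀ z ∈ V, w z ≤ 0)
    (hL : ∀ z ∈ V, 0 ≤ ellOp a₁ a₂ a₃ b₁ b₂ w z)
    {y q : Plane} (hy : y ∈ V) (hwy : w y = 0) (hqy : q ≠ y)
    (hneg : ∀ x, dist x q < dist y q → w x < 0) : False := by
  set r := dist y q with hr
  have hrpos : 0 < r := dist_pos.2 hqy.symm
  obtain ⟨ε₀, hε₀, hball⟩ := Metric.isOpen_iff.1 hV y hy
  -- The barrier is centred at the midpoint: the disk of radius `r / 2` about it meets the circle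
  -- about `q` only at `y`. On its points away from `y`, `w` is therefore strictly negative.
  set c := midpoint ℝ q y with hc
  have hcy : dist y c = r / 2 := by
    rw [hc, dist_right_midpoint, hr, dist_comm y q]; simp; ring
  set ρ := min (ε₀ / 2) (r / 4) with hρ
  have hρpos : 0 < ρ := by positivity
  have hKV : closedBall y ρ ⊆ V := by
    refine (closedBall_subset_ball ?_).trans hball
    exact (min_le_left _ _).trans_lt (by linarith)
  have hK : IsCompact (closedBall y ρ) := isCompact_closedBall y ρ
  have hcK : c ∉ closedBall y ρ := by
    rw [mem_closedBall, dist_comm, hcy, not_le]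
    exact (min_le_right _ _).trans_lt (by linarith)
  obtain ⟨α, hα, hsub⟩ := exists_ellOp_gaussBarrier_pos hK hcK (ha₁.mono hKV) (ha₂.mono hKV)
    (ha₃.mono hKV) (hb₁.mono hKV) (hb₂.mono hKV) (fun z hz => hpos z (hKV hz))
    (fun z hz => hdet z (hKV hz))
  have hwc : ContinuousOn w V := fun z hz => (hw z hz).continuousAt.continuousWithinAt
  obtain ⟨m, hm, hmS⟩ : ∃ m > 0, ∀ x ∈ sphere y ρ ∩ closedBall c (r / 2), w x ≤ -m := by
    have hS : IsCompact (sphere y ρ ∩ closedBall c (r / 2)) :=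
      (isCompact_sphere y ρ).inter_right isClosed_closedBall
    rcases (sphere y ρ ∩ closedBall c (r / 2)).eq_empty_or_nonempty with he | hne
    · exact ⟨1, one_pos, by simp [he]⟩
    obtain ⟨x₁, hx₁, hmax⟩ := hS.exists_isMaxOn hne
      (hwc.mono (Set.inter_subset_left.trans (sphere_subset_closedBall.trans hKV)))
    refine ⟨-w x₁, ?_, fun x hx => by simpa using hmax hx⟩
    have hlt : dist x₁ q < r := by
      have h1 := parallelogram_plane x₁ q y
      have h2 : dist x₁ c ≤ r / 2 := hx₁.2
      have h3 : dist x₁ y = ρ := hx₁.1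
      have h4 : dist q y = r := dist_comm _ _
      rw [h4, h3, ← hc] at h1
      refine lt_of_pow_lt_pow_left₀ 2 hrpos.le ?_
      have : dist x₁ c ^ 2 ≤ (r / 2) ^ 2 := pow_le_pow_left₀ dist_nonneg h2 2
      nlinarith [pow_pos hρpos 2]
    have := hneg x₁ hlt
    simpa using this
  set E := Real.exp (-α * (r / 2) ^ 2) with hE
  -- `E` is the barrier's value on the circle of radius `r / 2` about `c`. On the small sphere about
  -- `y`, `w ≤ -m` absorbs the added term inside that circle, and the added term is nonpositive
  -- outside it.
  set W : Plane → ℝ := fun x => w x + m * (gaussBarrier α c x - E) with hW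
  have hWy : W y = 0 := by
    simp [hW, hwy, gaussBarrier_eq, hcy, hE]
  have hWS : ∀ x ∈ sphere y ρ, W x ≤ 0 := by
    intro x hx
    by_cases hxc : dist x c ≤ r / 2
    · have h1 := hmS x ⟨hx, hxc⟩
      have h2 : gaussBarrier α c x ≤ 1 := by
        rw [gaussBarrier_eq, Real.exp_le_one_iff]
        nlinarith [sq_nonneg (dist x c)]
      have h3 : 0 < E := Real.exp_pos _
      simp only [hW]
      nlinarith
    · have h1 := hle x (hKV (sphere_subset_closedBall hx))
      have h2 : gaussBarrier α c x ≤ E := by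
        rw [gaussBarrier_eq, hE, Real.exp_le_exp]
        have : (r / 2) ^ 2 ≤ dist x c ^ 2 := pow_le_pow_left₀ (by positivity) (not_le.1 hxc).le 2
        nlinarith
      simp only [hW]
      nlinarith
  have hWd : ∀ x ∈ V, ContDiffAt ℝ ∞ W x := fun x hx =>
    (hw x hx).add (contDiffAt_const.mul
      ((contDiff_gaussBarrier α c).contDiffAt.sub contDiffAt_const))
  have hWc : ContinuousOn W (closedBall y ρ) := fun x hx =>
    (hWd x (hKV hx)).continuousAt.continuousWithinAt
  obtain ⟨x₀, hx₀, hmax⟩ := hK.exists_isMaxOn ⟨y, mem_closedBall_self hρpos.le⟩ hWc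
  -- If the maximum lies on the sphere, then it is at most `0 = W y`, so `y` is an interior maximum
  -- as well.
  obtain ⟨x₁, hx₁, hmax₁⟩ : ∃ x₁ ∈ ball y ρ, IsMaxOn W (closedBall y ρ) x₁ := by
    by_cases hb : x₀ ∈ ball y ρ
    · exact ⟨x₀, hb, hmax⟩
    · have hs : x₀ ∈ sphere y ρ := by
        rw [mem_sphere]; exact le_antisymm hx₀ (not_lt.1 hb)
      refine ⟨y, mem_ball_self hρpos, fun x hx => ?_⟩
      change W x ≤ W y
      rw [hWy]
      exact (hmax hx).trans (hWS x₀ hs)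
  have hx₁V : x₁ ∈ V := hKV (ball_subset_closedBall hx₁)
  have hloc : IsLocalMax W x₁ :=
    hmax₁.isLocalMax (mem_of_superset (isOpen_ball.mem_nhds hx₁) ball_subset_closedBall)
  have h1 := ellOp_nonpos_of_isLocalMax (b₁ := b₁) (b₂ := b₂) (hWd x₁ hx₁V) hloc (hpos x₁ hx₁V)
    (hdet x₁ hx₁V)
  rw [hW, ellOp_add_mul (hw x₁ hx₁V) (contDiff_gaussBarrier α c).contDiffAt] at h1
  have h2 := hL x₁ hx₁V
  have h3 := mul_pos hm (hsub x₁ (ball_subset_closedBall hx₁))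
  linarith

/-- The strong maximum principle of E. Hopf. -/
theorem strong_maximum_principle {V : Set Plane} (hV : IsOpen V) (hVc : IsPreconnected V)
    {a₁ a₂ a₃ b₁ b₂ w : Plane → ℝ}
    (ha₁ : ContinuousOn a₁ V) (ha₂ : ContinuousOn a₂ V) (ha₃ : ContinuousOn a₃ V)
    (hb₁ : ContinuousOn b₁ V) (hb₂ : ContinuousOn b₂ V) (hpos : ∀ z ∈ V, 0 < a₁ z)
    (hdet : ∀ z ∈ V, 0 < a₁ z * a₃ z - a₂ z ^ 2)
    (hw : ∀ z ∈ V, ContDiffAt ℝ ∞ w z) (hle : ∀ z ∈ V, w z ≤ 0)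
    (hL : ∀ z ∈ V, 0 ≤ ellOp a₁ a₂ a₃ b₁ b₂ w z)
    {p : Plane} (hp : p ∈ V) (hwp : w p = 0) : ∀ z ∈ V, w z = 0 := by
  have hwc : ContinuousOn w V := fun z hz => (hw z hz).continuousAt.continuousWithinAt
  have hopen : IsOpen {z | z ∈ V ∧ w z = 0} := by
    rw [Metric.isOpen_iff]
    rintro z ⟨hz, hwz⟩
    obtain ⟨ε₀, hε₀, hball⟩ := Metric.isOpen_iff.1 hV z hz
    have hcb : closedBall z (ε₀ / 2) ⊆ V :=
      (closedBall_subset_ball (by linarith)).trans hball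
    refine ⟨ε₀ / 4, by linarith, fun q hq => ?_⟩
    rw [mem_ball] at hq
    have hqV : q ∈ V := hball (by rw [mem_ball]; linarith)
    refine ⟨hqV, ?_⟩
    by_contra hne
    have hcompact : IsCompact (closedBall z (ε₀ / 2) ∩ w ⁻¹' {0}) :=
      (isCompact_closedBall _ _).of_isClosed_subset
        ((hwc.mono hcb).preimage_isClosed_of_isClosed isClosed_closedBall isClosed_singleton)
        Set.inter_subset_left
    have hzZ : z ∈ closedBall z (ε₀ / 2) ∩ w ⁻¹' {0} :=
      ⟨mem_closedBall_self (by linarith), hwz⟩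
    -- Take the zero nearest to `q`: `w` is negative on the open disk about `q` reaching to it. The
    -- radii `ε₀ / 4` and `ε₀ / 2` keep that disk inside the region where zeros were minimised over.
    obtain ⟨y, hyZ, hmin⟩ := hcompact.exists_isMinOn ⟨z, hzZ⟩
      (show Continuous fun x => dist x q by fun_prop).continuousOn
    have hmin' : ∀ x ∈ closedBall z (ε₀ / 2) ∩ w ⁻¹' {0}, dist y q ≤ dist x q :=
      fun x hx => hmin hx
    have hqy : q ≠ y := by
      rintro rfl
      exact hne hyZ.2
    have hyq : dist y q < ε₀ / 4 := (hmin' z hzZ).trans_lt (by rwa [dist_comm])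
    refine subsolution_not_touch hV ha₁ ha₂ ha₃ hb₁ hb₂ hpos hdet hw hle hL (hcb hyZ.1) hyZ.2
      hqy fun x hx => ?_
    have hxz : x ∈ closedBall z (ε₀ / 2) := by
      rw [mem_closedBall]
      linarith [dist_triangle x q z]
    refine lt_of_le_of_ne (hle x (hcb hxz)) fun h0 => ?_
    exact absurd (hmin' x ⟨hxz, h0⟩) (not_le.2 hx)
  have hopen' : IsOpen (V ∩ w ⁻¹' Set.Iio 0) := hwc.isOpen_inter_preimage hV isOpen_Iio
  have hsub := hVc.subset_left_of_subset_union hopen hopen' ?_ ?_ ⟨p, hp, hp, hwp⟩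
  · exact fun z hz => (hsub hz).2
  · rw [Set.disjoint_left]
    rintro z ⟨-, h1⟩ ⟨-, h2⟩
    simp only [Set.mem_preimage, Set.mem_Iio] at h2
    linarith
  · intro z hz
    rcases (hle z hz).lt_or_eq with h | h
    · exact Or.inr ⟨hz, h⟩
    · exact Or.inl ⟨hz, h⟩

/-! ### The minimal surface equation for graphs. -/

/-- The left hand side of the minimal surface equation for the graph of `v`. -/
noncomputable def mse (v : Plane → ℝ) (z : Plane) : ℝ :=
  (1 + pd 1 v z ^ 2) * pd 0 (pd 0 v) z
    - pd 0 v z * pd 1 v z * (pd 0 (pd 1 v) z + pd 1 (pd 0 v) z)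
    + (1 + pd 0 v z ^ 2) * pd 1 (pd 1 v) z

lemma ellOp_neg {a₁ a₂ a₃ b₁ b₂ w : Plane → ℝ} {z : Plane} (hw : ContDiffAt ℝ ∞ w z) :
    ellOp a₁ a₂ a₃ b₁ b₂ (fun x => - w x) z = - ellOp a₁ a₂ a₃ b₁ b₂ w z := by
  have h := ellOp_add_mul (a₁ := a₁) (a₂ := a₂) (a₃ := a₃) (b₁ := b₁) (b₂ := b₂) hw hw (-2) 0
  have h2 : (fun x => w x + -2 * (w x - 0)) = fun x => - w x := by funext x; ring
  rw [h2] at h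
  rw [h]; ring

lemma ellOp_sub {a₁ a₂ a₃ b₁ b₂ f g : Plane → ℝ} {z : Plane} (hf : ContDiffAt ℝ ∞ f z)
    (hg : ContDiffAt ℝ ∞ g z) :
    ellOp a₁ a₂ a₃ b₁ b₂ (fun x => f x - g x) z
      = ellOp a₁ a₂ a₃ b₁ b₂ f z - ellOp a₁ a₂ a₃ b₁ b₂ g z := by
  have h := ellOp_add_mul (a₁ := a₁) (a₂ := a₂) (a₃ := a₃) (b₁ := b₁) (b₂ := b₂) hf hg (-1) 0
  have h2 : (fun x => f x + -1 * (g x - 0)) = fun x => f x - g x := by funext x; ring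
  rw [h2] at h
  rw [h]; ring

/-- Touching principle for two solutions of the minimal surface equation. -/
theorem minimalGraph_touching {V : Set Plane} (hV : IsOpen V) (hVc : IsPreconnected V)
    {v₁ v₂ : Plane → ℝ} (h₁ : ∀ z ∈ V, ContDiffAt ℝ ∞ v₁ z) (h₂ : ∀ z ∈ V, ContDiffAt ℝ ∞ v₂ z)
    (hm₁ : ∀ z ∈ V, mse v₁ z = 0) (hm₂ : ∀ z ∈ V, mse v₂ z = 0) (hle : ∀ z ∈ V, v₁ z ≤ v₂ z)
    {p : Plane} (hp : p ∈ V) (heq : v₁ p = v₂ p) : ∀ z ∈ V, v₁ z = v₂ z := by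
  have c₁ : ∀ i, ContinuousOn (pd i v₁) V := fun i z hz =>
    ((h₁ z hz).pd i).continuousAt.continuousWithinAt
  have c₂ : ∀ i, ContinuousOn (pd i v₂) V := fun i z hz =>
    ((h₂ z hz).pd i).continuousAt.continuousWithinAt
  have c₃ : ∀ i j, ContinuousOn (pd i (pd j v₂)) V := fun i j z hz =>
    (((h₂ z hz).pd j).pd i).continuousAt.continuousWithinAt
  have c₁0 := c₁ 0
  have c₁1 := c₁ 1
  have c₂0 := c₂ 0
  have c₂1 := c₂ 1
  have c00 := c₃ 0 0
  have c01 := c₃ 0 1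
  have c10 := c₃ 1 0
  have c11 := c₃ 1 1
  -- The difference of the two equations is linear in `v₁ - v₂`: leading coefficients come from
  -- `v₁`, and differences of the quadratic gradient terms are factored against second derivatives
  -- of `v₂`. The determinant is `1 + |∇v₁|²`.
  have := strong_maximum_principle hV hVc (w := fun z => v₁ z - v₂ z)
    (a₁ := fun z => 1 + pd 1 v₁ z ^ 2) (a₂ := fun z => -(pd 0 v₁ z * pd 1 v₁ z))
    (a₃ := fun z => 1 + pd 0 v₁ z ^ 2)
    (b₁ := fun z => -(pd 1 v₁ z * (pd 0 (pd 1 v₂) z + pd 1 (pd 0 v₂) z))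
      + (pd 0 v₁ z + pd 0 v₂ z) * pd 1 (pd 1 v₂) z)
    (b₂ := fun z => (pd 1 v₁ z + pd 1 v₂ z) * pd 0 (pd 0 v₂) z
      - pd 0 v₂ z * (pd 0 (pd 1 v₂) z + pd 1 (pd 0 v₂) z))
    (by fun_prop) (by fun_prop) (by fun_prop) (by fun_prop) (by fun_prop)
    (fun z _ => by positivity)
    (fun z _ => by nlinarith [sq_nonneg (pd 0 v₁ z), sq_nonneg (pd 1 v₁ z)])
    (fun z hz => (h₁ z hz).sub (h₂ z hz)) (fun z hz => sub_nonpos.2 (hle z hz)) ?_ hp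
    (sub_eq_zero.2 heq)
  · exact fun z hz => sub_eq_zero.1 (this z hz)
  · intro z hz
    rw [ellOp_sub (h₁ z hz) (h₂ z hz)]
    have e1 := hm₁ z hz
    have e2 := hm₂ z hz
    simp only [mse] at e1 e2
    simp only [ellOp]
    apply le_of_eq
    linear_combination e2 - e1

/-- A derivative of a solution of the minimal surface equation which does not change sign either
vanishes nowhere or vanishes identically. -/
theorem minimalGraph_pd_eq_zero {V : Set Plane} (hV : IsOpen V) (hVc : IsPreconnected V)
    {v : Plane → ℝ} (h : ∀ z ∈ V, ContDiffAt ℝ ∞ v z) (hm : ∀ z ∈ V, mse v z = 0)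
    (hsign : (∀ z ∈ V, pd 1 v z ≤ 0) ∨ (∀ z ∈ V, 0 ≤ pd 1 v z))
    {p : Plane} (hp : p ∈ V) (heq : pd 1 v p = 0) : ∀ z ∈ V, pd 1 v z = 0 := by
  have c₁ : ∀ i, ContinuousOn (pd i v) V := fun i z hz =>
    ((h z hz).pd i).continuousAt.continuousWithinAt
  have c₃ : ∀ i j, ContinuousOn (pd i (pd j v)) V := fun i j z hz =>
    (((h z hz).pd j).pd i).continuousAt.continuousWithinAt
  have c₁0 := c₁ 0
  have c₁1 := c₁ 1
  have c00 := c₃ 0 0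
  have c01 := c₃ 0 1
  have c10 := c₃ 1 0
  have c11 := c₃ 1 1
  set a₁ : Plane → ℝ := fun z => 1 + pd 1 v z ^ 2 with ha₁
  set a₂ : Plane → ℝ := fun z => -(pd 0 v z * pd 1 v z) with ha₂
  set a₃ : Plane → ℝ := fun z => 1 + pd 0 v z ^ 2 with ha₃
  set b₁ : Plane → ℝ := fun z => -(pd 1 v z * (pd 0 (pd 1 v) z + pd 1 (pd 0 v) z))
      + 2 * pd 0 v z * pd 1 (pd 1 v) z with hb₁
  set b₂ : Plane → ℝ := fun z => 2 * pd 1 v z * pd 0 (pd 0 v) z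
      - pd 0 v z * (pd 0 (pd 1 v) z + pd 1 (pd 0 v) z) with hb₂
  -- Differentiating the equation in direction 1 and commuting derivatives shows that `pd 1 v`
  -- solves the linearised equation.
  have hell : ∀ z ∈ V, ellOp a₁ a₂ a₃ b₁ b₂ (pd 1 v) z = 0 := by
    intro z hz
    have hmse : pd 1 (mse v) z = 0 := by
      have : mse v =ᶠ[𝓝 z] fun _ => 0 := by
        filter_upwards [hV.mem_nhds hz] with y hy using hm y hy
      rw [pd_congr this, pd_const]
    have hpd : ∀ i, ContDiffAt ℝ ∞ (pd i v) z := fun i => (h z hz).pd i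
    have hpp : ∀ i j, ContDiffAt ℝ ∞ (pd i (pd j v)) z := fun i j => (hpd j).pd i
    have hsw : ∀ i, pd 1 (pd i v) =ᶠ[𝓝 z] pd i (pd 1 v) := fun i => by
      filter_upwards [hV.mem_nhds hz] with y hy using pd_comm (h y hy) 1 i
    have hsw3 : ∀ i j, pd 1 (pd i (pd j v)) z = pd i (pd j (pd 1 v)) z := fun i j => by
      rw [pd_comm (hpd j), pd_congr (hsw j)]
    have d0 := (hpd 0).diffAt
    have d1 := (hpd 1).diffAt
    have d00 := (hpp 0 0).diffAt
    have d01 := (hpp 0 1).diffAt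
    have d10 := (hpp 1 0).diffAt
    have d11 := (hpp 1 1).diffAt
    have hexp : (mse v) = fun z => (1 + pd 1 v z * pd 1 v z) * pd 0 (pd 0 v) z
        - pd 0 v z * pd 1 v z * (pd 0 (pd 1 v) z + pd 1 (pd 0 v) z)
        + (1 + pd 0 v z * pd 0 v z) * pd 1 (pd 1 v) z := by
      funext z; simp only [mse]; ring
    rw [hexp, pd_add (by fun_prop) (by fun_prop), pd_sub (by fun_prop) (by fun_prop),
      pd_mul (by fun_prop) d00, pd_mul (by fun_prop) (by fun_prop), pd_mul (by fun_prop) d11,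
      pd_add (by fun_prop) (by fun_prop), pd_add (by fun_prop) (by fun_prop),
      pd_add (by fun_prop) (by fun_prop),
      pd_mul d1 d1, pd_mul d0 d1, pd_mul d0 d0, pd_const] at hmse
    simp only [hsw3, (hsw 0).self_of_nhds] at hmse
    simp only [ellOp, ha₁, ha₂, ha₃, hb₁, hb₂, (hsw 0).self_of_nhds]
    linear_combination hmse - pd 1 v z * pd 0 v z * pd_comm (hpd 1) 1 0
  have k₁ : ContinuousOn a₁ V := by fun_prop
  have k₂ : ContinuousOn a₂ V := by fun_prop
  have k₃ : ContinuousOn a₃ V := by fun_prop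
  have k₄ : ContinuousOn b₁ V := by fun_prop
  have k₅ : ContinuousOn b₂ V := by fun_prop
  have hpos : ∀ z ∈ V, 0 < a₁ z := fun z _ => by simp only [ha₁]; positivity
  have hdet : ∀ z ∈ V, 0 < a₁ z * a₃ z - a₂ z ^ 2 := fun z _ => by
    simp only [ha₁, ha₂, ha₃]
    nlinarith [sq_nonneg (pd 0 v z), sq_nonneg (pd 1 v z)]
  rcases hsign with hs | hs
  · exact strong_maximum_principle hV hVc k₁ k₂ k₃ k₄ k₅ hpos hdet (fun z hz => (h z hz).pd 1) hs
      (fun z hz => (hell z hz).ge) hp heq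
  · have := strong_maximum_principle hV hVc k₁ k₂ k₃ k₄ k₅ hpos hdet (w := fun z => - pd 1 v z)
      (fun z hz => ((h z hz).pd 1).neg) (fun z hz => neg_nonpos.2 (hs z hz))
      (fun z hz => by rw [ellOp_neg ((h z hz).pd 1), hell z hz, neg_zero]) hp (by simp [heq])
    exact fun z hz => neg_eq_zero.1 (this z hz)

/-! ### Minimal immersions and their local graph representations. -/

/-- A smooth immersion of an open subset of the plane with vanishing mean curvature. -/
structure IsMinimalImmersionOn (F : Plane → Space) (D : Set Plane) : Prop where
  isOpen : IsOpen D
  smooth : ∀ z ∈ D, ContDiffAt ℝ ∞ F z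
  immersion : ∀ z ∈ D, Function.Injective (fderiv ℝ F z)
  minimal : ∀ z ∈ D, meanCurvatureVector F z = 0

lemma IsMinimalDisk.isMinimalImmersionOn {F : Plane → Space} {s : Set Space}
    (h : IsMinimalDisk F s) : IsMinimalImmersionOn F (ball 0 1) where
  isOpen := isOpen_ball
  smooth _ hz := h.smooth.contDiffAt (isOpen_ball.mem_nhds hz)
  immersion := h.immersion
  minimal := h.minimal

lemma IsMinimalImmersionOn.add_const {F : Plane → Space} {D : Set Plane}
    (h : IsMinimalImmersionOn F D) (c : Space) : IsMinimalImmersionOn (fun z => F z + c) D := by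
  have hf : fderiv ℝ (fun z => F z + c) = fderiv ℝ F := by
    funext z; exact fderiv_add_const c
  have hp : ∀ i, partialDeriv i (fun z => F z + c) = partialDeriv i F := fun i => by
    funext z; simp only [partialDeriv, hf]
  refine ⟨h.isOpen, fun z hz => (h.smooth z hz).add contDiffAt_const, fun z hz => ?_,
    fun z hz => ?_⟩
  · rw [hf]; exact h.immersion z hz
  · have := h.minimal z hz
    simp only [meanCurvatureVector, firstFundamentalForm, secondFundamentalForm, tangentPlane, hp,
      hf] at this ⊢
    exact this

lemma pd_component {F : Plane → Space} {z : Plane} (hF : DifferentiableAt ℝ F z) (a : Fin 2)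
    (k : Fin 3) : pd a (fun y => F y k) z = partialDeriv a F z k := by
  have h := ((EuclideanSpace.proj k : Space →L[ℝ] ℝ).hasFDerivAt.comp z hF.hasFDerivAt).fderiv
  simp only [pd, partialDeriv]
  exact congrArg (fun L : Plane →L[ℝ] ℝ => L (EuclideanSpace.single a 1)) h

lemma pd_comp {v : Plane → ℝ} {φ : Plane → Plane} {z : Plane}
    (hv : DifferentiableAt ℝ v (φ z)) (hφ : DifferentiableAt ℝ φ z) (a : Fin 2) :
    pd a (fun y => v (φ y)) z = pd 0 v (φ z) * pd a (fun y => φ y 0) z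
      + pd 1 v (φ z) * pd a (fun y => φ y 1) z := by
  have hc : ∀ j, pd a (fun y => φ y j) z = fderiv ℝ φ z (EuclideanSpace.single a 1) j := by
    intro j
    have h := ((EuclideanSpace.proj j : Plane →L[ℝ] ℝ).hasFDerivAt.comp z hφ.hasFDerivAt).fderiv
    exact congrArg (fun L : Plane →L[ℝ] ℝ => L (EuclideanSpace.single a 1)) h
  have h := (hv.hasFDerivAt.comp z hφ.hasFDerivAt).fderiv
  rw [hc, hc]
  change fderiv ℝ (v ∘ φ) z _ = _
  rw [h, ContinuousLinearMap.comp_apply, fderiv_apply_eq_pd]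
  ring

lemma fderiv_apply_eq_partialDeriv (F : Plane → Space) (z h : Plane) :
    fderiv ℝ F z h = h 0 • partialDeriv 0 F z + h 1 • partialDeriv 1 F z := by
  conv_lhs => rw [plane_eq_sum h]
  simp [partialDeriv]

/-- The minimal surface equation tested against a normal vector. -/
lemma minimal_inner_normal {F : Plane → Space} {z : Plane} (hmin : meanCurvatureVector F z = 0)
    {n : Space} (hn : ∀ a, inner ℝ n (partialDeriv a F z) = 0)
    (hdet : (firstFundamentalForm F z).det ≠ 0) :
    inner ℝ (partialDeriv 1 F z) (partialDeriv 1 F z)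
        * inner ℝ n (partialDeriv 0 (partialDeriv 0 F) z)
      - inner ℝ (partialDeriv 0 F z) (partialDeriv 1 F z)
        * (inner ℝ n (partialDeriv 0 (partialDeriv 1 F) z)
          + inner ℝ n (partialDeriv 1 (partialDeriv 0 F) z))
      + inner ℝ (partialDeriv 0 F z) (partialDeriv 0 F z)
        * inner ℝ n (partialDeriv 1 (partialDeriv 1 F) z) = 0 := by
  have hnorm : n ∈ (tangentPlane F z)ᗮ := by
    rw [Submodule.mem_orthogonal']
    rintro _ ⟨h, rfl⟩
    change inner ℝ n (fderiv ℝ F z h) = 0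
    rw [fderiv_apply_eq_partialDeriv, inner_add_right, inner_smul_right, inner_smul_right, hn, hn]
    simp
  -- The normal projection is self-adjoint and fixes `n`, so it drops out of the inner product.
  have hA : ∀ i j, inner ℝ n (secondFundamentalForm F z i j)
      = inner ℝ n (partialDeriv i (partialDeriv j F) z) := fun i j => by
    rw [secondFundamentalForm, ← Submodule.inner_starProjection_left_eq_right,
      Submodule.starProjection_eq_self_iff.2 hnorm]
  have h := congrArg (fun w => inner ℝ n w) hmin
  have hsymm : inner ℝ (partialDeriv 1 F z) (partialDeriv 0 F z)
      = inner ℝ (partialDeriv 0 F z) (partialDeriv 1 F z) := real_inner_comm _ _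
  simp only [meanCurvatureVector, Fin.sum_univ_two, inner_add_right, inner_smul_right, hA,
    inner_zero_right, Matrix.inv_def, Matrix.smul_apply, Matrix.adjugate_fin_two, smul_eq_mul,
    Ring.inverse_eq_inv'] at h
  simp only [firstFundamentalForm, Matrix.of_apply, Matrix.cons_val_zero, Matrix.cons_val_one,
    Matrix.cons_val', Matrix.cons_val_fin_one, hsymm] at h hdet
  set d := (Matrix.of fun i j => inner ℝ (partialDeriv i F z) (partialDeriv j F z)).det
  have : d⁻¹ ≠ 0 := inv_ne_zero hdet
  apply mul_left_cancel₀ this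
  rw [mul_zero, ← h]
  ring

/-- The projection of space to the plane given by two coordinates. -/
noncomputable def coordProj (i j : Fin 3) (p : Space) : Plane := !₂[p i, p j]

lemma contDiff_coordProj (i j : Fin 3) : ContDiff ℝ ∞ (coordProj i j) := by
  rw [contDiff_euclidean]
  intro a
  fin_cases a
  · exact (EuclideanSpace.proj i : Space →L[ℝ] ℝ).contDiff
  · exact (EuclideanSpace.proj j : Space →L[ℝ] ℝ).contDiff

/-- Three pairwise distinct coordinates of space. -/
def IsCoordTriple (i j k : Fin 3) : Prop := i ≠ j ∧ j ≠ k ∧ i ≠ k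

lemma IsCoordTriple.sum_eq {i j k : Fin 3} (h : IsCoordTriple i j k) (f : Fin 3 → ℝ) :
    ∑ l, f l = f i + f j + f k := by
  obtain ⟨h1, h2, h3⟩ := h
  rw [Fin.sum_univ_three]
  fin_cases i <;> fin_cases j <;> fin_cases k <;> simp_all <;> ring

lemma IsCoordTriple.inner_eq {i j k : Fin 3} (h : IsCoordTriple i j k) (x y : Space) :
    inner ℝ x y = x i * y i + x j * y j + x k * y k := by
  rw [PiLp.inner_apply, h.sum_eq]
  simp [mul_comm]

lemma IsCoordTriple.eq_of_coord_eq {i j k : Fin 3} (h : IsCoordTriple i j k) {x y : Space}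
    (hij : coordProj i j x = coordProj i j y) (hk : x k = y k) : x = y := by
  have hi : x i = y i := congrArg (fun p : Plane => p 0) hij
  have hj : x j = y j := congrArg (fun p : Plane => p 1) hij
  rw [← sub_eq_zero, ← norm_eq_zero, ← sq_eq_zero_iff, ← real_inner_self_eq_norm_sq, h.inner_eq]
  simp [hi, hj, hk]

/-- If a minimal immersion is locally the graph of `v` then `v` satisfies the minimal surface
equation. -/
lemma mse_eq_zero {F : Plane → Space} {D : Set Plane} (hF : IsMinimalImmersionOn F D)
    {i j k : Fin 3} (hijk : IsCoordTriple i j k) {z : Plane} (hz : z ∈ D) {v : Plane → ℝ}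
    (hv : ContDiffAt ℝ ∞ v (coordProj i j (F z)))
    (hgraph : ∀ᶠ y in 𝓝 z, v (coordProj i j (F y)) = F y k)
    (hdet : pd 0 (fun y => F y i) z * pd 1 (fun y => F y j) z
      - pd 1 (fun y => F y i) z * pd 0 (fun y => F y j) z ≠ 0) :
    mse v (coordProj i j (F z)) = 0 := by
  set φ : Plane → Plane := fun y => coordProj i j (F y) with hφ
  have hFz := hF.smooth z hz
  have hFl : ∀ l, ContDiffAt ℝ ∞ (fun y => F y l) z := fun l =>
    (EuclideanSpace.proj l : Space →L[ℝ] ℝ).contDiff.contDiffAt.comp z hFz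
  have hφz : ContDiffAt ℝ ∞ φ z := (contDiff_coordProj i j).contDiffAt.comp z hFz
  have hFd : ∀ᶠ y in 𝓝 z, DifferentiableAt ℝ F y := by
    filter_upwards [hF.isOpen.mem_nhds hz] with y hy
    exact (hF.smooth y hy).differentiableAt (by simp)
  have hφd : ∀ᶠ y in 𝓝 z, DifferentiableAt ℝ φ y := by
    filter_upwards [hF.isOpen.mem_nhds hz] with y hy
    exact ((contDiff_coordProj i j).contDiffAt.comp y (hF.smooth y hy)).differentiableAt (by simp)
  have hvd : ∀ᶠ y in 𝓝 z, DifferentiableAt ℝ v (φ y) := by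
    filter_upwards [hφz.continuousAt.eventually hv.eventually_contDiffAt] with y hy
    exact hy.differentiableAt (by simp)
  -- first derivatives
  have h1 : ∀ a, pd a (fun y => F y k) =ᶠ[𝓝 z] fun y =>
      pd 0 v (φ y) * pd a (fun y => F y i) y + pd 1 v (φ y) * pd a (fun y => F y j) y := by
    intro a
    filter_upwards [hφd, hvd, hgraph.eventually_nhds] with y hy1 hy2 hy3
    rw [← pd_congr (f := fun y => v (φ y)) hy3, pd_comp hy2 hy1]
    rfl
  have hpv : ∀ b, DifferentiableAt ℝ (fun y => pd b v (φ y)) z := fun b =>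
    DifferentiableAt.comp (g := pd b v) z (hv.pd b).diffAt (hφz.differentiableAt (by simp))
  have h2 : ∀ a b, pd b (pd a (fun y => F y k)) z =
      (pd 0 (pd 0 v) (φ z) * pd b (fun y => F y i) z
        + pd 1 (pd 0 v) (φ z) * pd b (fun y => F y j) z) * pd a (fun y => F y i) z
      + pd 0 v (φ z) * pd b (pd a (fun y => F y i)) z
      + ((pd 0 (pd 1 v) (φ z) * pd b (fun y => F y i) z
        + pd 1 (pd 1 v) (φ z) * pd b (fun y => F y j) z) * pd a (fun y => F y j) z
      + pd 1 v (φ z) * pd b (pd a (fun y => F y j)) z) := by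
    intro a b
    have di := ((hFl i).pd a).diffAt
    have dj := ((hFl j).pd a).diffAt
    rw [pd_congr (h1 a), pd_add ((hpv 0).fun_mul di) ((hpv 1).fun_mul dj), pd_mul (hpv 0) di,
      pd_mul (hpv 1) dj, pd_comp (hv.pd 0).diffAt (hφz.differentiableAt (by simp)), pd_comp (hv.pd 1).diffAt (hφz.differentiableAt (by simp))]
    rfl
  have c1 : ∀ a l, partialDeriv a F z l = pd a (fun y => F y l) z := fun a l =>
    (pd_component hFd.self_of_nhds a l).symm
  have c2 : ∀ a b l, partialDeriv b (partialDeriv a F) z l = pd b (pd a (fun y => F y l)) z := by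
    intro a b l
    have hd : DifferentiableAt ℝ (partialDeriv a F) z :=
      ((hFz.fderiv_right (m := ∞) (by simp)).clm_apply contDiffAt_const).differentiableAt (by simp)
    rw [← pd_component hd]
    refine pd_congr ?_ b
    filter_upwards [hFd] with y hy using (pd_component hy a l).symm
  set p := pd 0 v (φ z)
  set q := pd 1 v (φ z)
  -- The graph normal `(-p, -q, 1)` in the coordinates `i, j, k`. Tested against it, the mean
  -- curvature equation becomes the squared Jacobian times `mse v`.
  set n : Space := -p • EuclideanSpace.single i 1 - q • EuclideanSpace.single j 1
    + EuclideanSpace.single k 1 with hn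
  have ni : n i = -p := by simp [hn, hijk.1, hijk.2.2]
  have nj : n j = -q := by simp [hn, hijk.1.symm, hijk.2.1]
  have nk : n k = 1 := by simp [hn, hijk.2.1.symm, hijk.2.2.symm]
  have h1z : ∀ a, pd a (fun y => F y k) z = p * pd a (fun y => F y i) z
    + q * pd a (fun y => F y j) z := fun a => (h1 a).self_of_nhds
  have key := minimal_inner_normal (hF.minimal z hz) (n := n) ?_ ?_
  · simp only [hijk.inner_eq, c1, c2, ni, nj, nk, h2, h1z] at key
    refine mul_left_cancel₀ (pow_ne_zero 2 hdet) ?_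
    simp only [mse]
    linear_combination key
  · intro a
    rw [hijk.inner_eq, c1, c1, c1, ni, nj, nk, h1z]
    ring
  -- Lagrange's identity: the Gram determinant is the sum of the squared 2×2 minors, one of which is
  -- the given Jacobian.
  · rw [Matrix.det_fin_two]
    simp only [firstFundamentalForm, Matrix.of_apply, hijk.inner_eq, c1]
    apply ne_of_gt
    have := sq_pos_of_ne_zero hdet
    nlinarith [sq_nonneg (pd 0 (fun y => F y i) z * pd 1 (fun y => F y k) z
      - pd 1 (fun y => F y i) z * pd 0 (fun y => F y k) z),
      sq_nonneg (pd 0 (fun y => F y j) z * pd 1 (fun y => F y k) z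
      - pd 1 (fun y => F y j) z * pd 0 (fun y => F y k) z)]

/-- If the determinant vanished, the cofactor vectors `(-B, A)` and `(-E, C)` would lie in the
kernel. All entries would be zero, and then `(1, 0)` would be in the kernel. -/
lemma jacobian_ne_zero {φ : Plane → Plane} {z : Plane} (hφ : DifferentiableAt ℝ φ z)
    (hinj : Function.Injective (fderiv ℝ φ z)) :
    pd 0 (fun y => φ y 0) z * pd 1 (fun y => φ y 1) z
      - pd 1 (fun y => φ y 0) z * pd 0 (fun y => φ y 1) z ≠ 0 := by
  have hc : ∀ (j : Fin 2) (h : Plane), fderiv ℝ φ z h j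
      = h 0 * pd 0 (fun y => φ y j) z + h 1 * pd 1 (fun y => φ y j) z := by
    intro j h
    rw [← fderiv_apply_eq_pd]
    have h' := ((EuclideanSpace.proj j : Plane →L[ℝ] ℝ).hasFDerivAt.comp z hφ.hasFDerivAt).fderiv
    exact (congrArg (fun L : Plane →L[ℝ] ℝ => L h) h').symm
  set A := pd 0 (fun y => φ y 0) z
  set B := pd 1 (fun y => φ y 0) z
  set C := pd 0 (fun y => φ y 1) z
  set E := pd 1 (fun y => φ y 1) z
  intro hdet
  have hker : ∀ a b : ℝ, a * A + b * B = 0 → a * C + b * E = 0 → a = 0 ∧ b = 0 := by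
    intro a b h1 h2
    have : (!₂[a, b] : Plane) = 0 := by
      apply hinj
      rw [map_zero]
      ext i
      rw [hc]
      fin_cases i
      · simpa using h1
      · simpa using h2
    exact ⟨by simpa using congrArg (fun p : Plane => p 0) this,
      by simpa using congrArg (fun p : Plane => p 1) this⟩
  obtain ⟨hB, hA⟩ := hker (-B) A (by ring) (by linarith)
  obtain ⟨hE, hC⟩ := hker (-E) C (by linarith) (by ring)
  have := hker 1 0 (by simp [hA]) (by simp [hC])
  simp at this

/-- Near a point at which the `k`-th component of some normal vector does not vanish, a minimal
immersion is the graph of a solution of the minimal surface equation in the direction `k`. -/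
theorem exists_local_graph {F : Plane → Space} {D : Set Plane} (hF : IsMinimalImmersionOn F D)
    {i j k : Fin 3} (hijk : IsCoordTriple i j k) {z₀ : Plane} (hz₀ : z₀ ∈ D) {n : Space}
    (hn : ∀ h, inner ℝ n (fderiv ℝ F z₀ h) = 0) (hnk : n k ≠ 0) :
    ∃ (e : OpenPartialHomeomorph Plane Plane) (R : ℝ), 0 < R ∧ z₀ ∈ e.source ∧
      (∀ z, e z = coordProj i j (F z)) ∧ ∀ y ∈ ball (coordProj i j (F z₀)) R,
        y ∈ e.target ∧ e.symm y ∈ D ∧ ContDiffAt ℝ ∞ e.symm y ∧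
        mse (fun y => F (e.symm y) k) y = 0 := by
  set φ : Plane → Plane := fun y => coordProj i j (F y) with hφ
  have hφs : ∀ z ∈ D, ContDiffAt ℝ ∞ φ z := fun z hz =>
    (contDiff_coordProj i j).contDiffAt.comp z (hF.smooth z hz)
  have hφd : ∀ z ∈ D, DifferentiableAt ℝ φ z := fun z hz =>
    (hφs z hz).differentiableAt (by simp)
  have hcomp : ∀ z ∈ D, ∀ h, fderiv ℝ φ z h = coordProj i j (fderiv ℝ F z h) := by
    intro z hz h
    have hc : ∀ l, fderiv ℝ φ z h l = coordProj i j (fderiv ℝ F z h) l := by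
      intro l
      have h1 := ((EuclideanSpace.proj l : Plane →L[ℝ] ℝ).hasFDerivAt.comp z
        (hφd z hz).hasFDerivAt).fderiv
      have hFd := ((hF.smooth z hz).differentiableAt (by simp)).hasFDerivAt
      fin_cases l
      · have h2 := ((EuclideanSpace.proj i : Space →L[ℝ] ℝ).hasFDerivAt.comp z hFd).fderiv
        exact congrArg (fun L : Plane →L[ℝ] ℝ => L h) (h1.symm.trans h2)
      · have h2 := ((EuclideanSpace.proj j : Space →L[ℝ] ℝ).hasFDerivAt.comp z hFd).fderiv
        exact congrArg (fun L : Plane →L[ℝ] ℝ => L h) (h1.symm.trans h2)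
    ext l; exact hc l
  -- A tangent vector killed by the projection has only a `k`-th component, and orthogonality to `n`
  -- with `n k ≠ 0` kills that too.
  have hinj : Function.Injective (fderiv ℝ φ z₀) := by
    rw [injective_iff_map_eq_zero]
    intro h hh
    rw [hcomp z₀ hz₀] at hh
    have hi : fderiv ℝ F z₀ h i = 0 := congrArg (fun p : Plane => p 0) hh
    have hj : fderiv ℝ F z₀ h j = 0 := congrArg (fun p : Plane => p 1) hh
    have hk := hn h
    rw [hijk.inner_eq, hi, hj] at hk
    have hk' : fderiv ℝ F z₀ h k = 0 := by simpa [hnk] using hk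
    have : fderiv ℝ F z₀ h = 0 := hijk.eq_of_coord_eq (by rw [hh]; ext l; fin_cases l <;> rfl) hk'
    exact (injective_iff_map_eq_zero _).1 (hF.immersion z₀ hz₀) h this
  obtain ⟨L, hL⟩ : ∃ L : Plane ≃L[ℝ] Plane, (L : Plane →L[ℝ] Plane) = fderiv ℝ φ z₀ :=
    ⟨(LinearEquiv.ofInjectiveEndo (fderiv ℝ φ z₀ : Plane →ₗ[ℝ] Plane) hinj).toContinuousLinearEquiv,
      by ext; rfl⟩
  have hderiv : HasFDerivAt φ (L : Plane →L[ℝ] Plane) z₀ := by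
    rw [hL]; exact (hφd z₀ hz₀).hasFDerivAt
  set e := (hφs z₀ hz₀).toOpenPartialHomeomorph φ hderiv (by simp) with he
  have he_coe : ∀ z, e z = φ z := fun z => rfl
  have hz₀s : z₀ ∈ e.source :=
    (hφs z₀ hz₀).mem_toOpenPartialHomeomorph_source hderiv (by simp)
  have hfc : ContinuousAt (fderiv ℝ φ) z₀ :=
    ((hφs z₀ hz₀).fderiv_right (m := ∞) (by simp)).continuousAt
  -- Invertibility of the differential is an open condition, which makes the inverse smooth on a
  -- whole disk and not only at its centre.
  have hW : ∀ᶠ z in 𝓝 z₀, z ∈ D ∧ ∃ L : Plane ≃L[ℝ] Plane,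
      (L : Plane →L[ℝ] Plane) = fderiv ℝ φ z := by
    refine (hF.isOpen.eventually_mem hz₀).and ?_
    have := L.nhds
    rw [hL] at this
    exact hfc this
  have htarget : e.target ∈ 𝓝 (φ z₀) := e.open_target.mem_nhds (e.map_source hz₀s)
  have hsymm : Tendsto e.symm (𝓝 (φ z₀)) (𝓝 z₀) := by
    have := (e.continuousAt_symm (e.map_source hz₀s)).tendsto
    rwa [e.left_inv hz₀s] at this
  obtain ⟨R, hR, hball⟩ := Metric.mem_nhds_iff.1 (inter_mem htarget (hsymm.eventually hW))
  refine ⟨e, R, hR, hz₀s, he_coe, fun y hy => ?_⟩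
  obtain ⟨hyt, hyD, L', hL'⟩ := hball hy
  have hφy : φ (e.symm y) = y := e.right_inv hyt
  have hsm : ContDiffAt ℝ ∞ e.symm y := by
    refine e.contDiffAt_symm (f₀' := L') hyt ?_ (hφs _ hyD)
    rw [hL']; exact (hφd _ hyD).hasFDerivAt
  refine ⟨hyt, hyD, hsm, ?_⟩
  have hv : ContDiffAt ℝ ∞ (fun y => F (e.symm y) k) y :=
    (EuclideanSpace.proj k : Space →L[ℝ] ℝ).contDiff.contDiffAt.comp y
      ((hF.smooth _ hyD).comp y hsm)
  have := mse_eq_zero hF hijk hyD (v := fun y => F (e.symm y) k) ?_ ?_ ?_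
  · change mse _ (φ (e.symm y)) = 0 at this
    rwa [hφy] at this
  · change ContDiffAt ℝ ∞ _ (φ (e.symm y))
    rwa [hφy]
  · filter_upwards [e.open_source.mem_nhds (e.map_target hyt)] with x hx
    change F (e.symm (e x)) k = F x k
    rw [e.left_inv hx]
  · refine jacobian_ne_zero (hφd _ hyD) ?_
    rw [← hL']
    exact L'.injective

/-! ### Touching principles for minimal immersions. -/

lemma exists_coordTriple (k : Fin 3) : ∃ i j, IsCoordTriple i j k := by
  unfold IsCoordTriple
  revert k
  decide

lemma mse_affine (α β γ : ℝ) (z : Plane) : mse (fun y => α + β * y 0 + γ * y 1) z = 0 := by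
  have hd : ∀ (j : Fin 2) (z : Plane), DifferentiableAt ℝ (fun y : Plane => y j) z := fun j z =>
    (contDiff_coord j).contDiffAt.diffAt
  have h0 := hd 0
  have h1 := hd 1
  have h : ∀ i, pd i (fun y : Plane => α + β * y 0 + γ * y 1)
      = fun _ => β * (if (0 : Fin 2) = i then 1 else 0) + γ * (if (1 : Fin 2) = i then 1 else 0) := by
    intro i
    funext y
    rw [pd_add (((differentiableAt_const _).fun_add ((differentiableAt_const _).fun_mul (h0 y))))
      ((differentiableAt_const _).fun_mul (h1 y)),
      pd_add (differentiableAt_const _) ((differentiableAt_const _).fun_mul (h0 y)),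
      pd_mul (differentiableAt_const _) (h0 y), pd_mul (differentiableAt_const _) (h1 y),
      pd_const, pd_const, pd_const, pd_coord, pd_coord]
    ring
  simp only [mse, h, pd_const]
  ring

lemma contDiff_affine (α β γ : ℝ) : ContDiff ℝ ∞ (fun y : Plane => α + β * y 0 + γ * y 1) := by
  have h0 := contDiff_coord 0
  have h1 := contDiff_coord 1
  fun_prop

lemma coordProj_add (i j : Fin 3) (p q : Space) :
    coordProj i j (p + q) = coordProj i j p + coordProj i j q := by
  ext l; fin_cases l <;> rfl

lemma coordProj_smul (i j : Fin 3) (s : ℝ) (q : Space) :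
    coordProj i j (s • q) = s • coordProj i j q := by
  ext l; fin_cases l <;> rfl

lemma coordProj_symm_apply {F : Plane → Space} {i j : Fin 3}
    {e : OpenPartialHomeomorph Plane Plane} (he : ∀ z, e z = coordProj i j (F z)) {y : Plane}
    (hy : y ∈ e.target) : coordProj i j (F (e.symm y)) = y := by
  rw [← he, e.right_inv hy]

lemma contDiffAt_height {F : Plane → Space} {D : Set Plane} (hF : IsMinimalImmersionOn F D)
    {ψ : Plane → Plane} {y : Plane} (hy : ψ y ∈ D) (hψ : ContDiffAt ℝ ∞ ψ y) (k : Fin 3) :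
    ContDiffAt ℝ ∞ (fun y => F (ψ y) k) y :=
  (EuclideanSpace.proj k : Space →L[ℝ] ℝ).contDiff.contDiffAt.comp y
    ((hF.smooth _ hy).comp y hψ)

/-- A linear function on a minimal surface is locally constant near an interior maximum. -/
theorem eventually_inner_eq_of_isLocalMax {F : Plane → Space} {D : Set Plane}
    (hF : IsMinimalImmersionOn F D) {c : Space} {z₀ : Plane} (hz₀ : z₀ ∈ D)
    (hmax : IsLocalMax (fun z => inner ℝ c (F z)) z₀) :
    ∀ᶠ z in 𝓝 z₀, inner ℝ c (F z) = inner ℝ c (F z₀) := by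
  by_cases hc : c = 0
  · simp [hc]
  obtain ⟨k, hk⟩ : ∃ k, c k ≠ 0 := by
    by_contra! h
    exact hc (by ext l; exact h l)
  obtain ⟨i, j, hijk⟩ := exists_coordTriple k
  have hFd := ((hF.smooth z₀ hz₀).differentiableAt (by simp)).hasFDerivAt
  have hn : ∀ h, inner ℝ c (fderiv ℝ F z₀ h) = 0 := by
    intro h
    have h1 := ((innerSL ℝ c).hasFDerivAt.comp z₀ hFd).fderiv
    have h2 : fderiv ℝ (fun z => inner ℝ c (F z)) z₀ = 0 := hmax.fderiv_eq_zero
    have h3 : fderiv ℝ (⇑(innerSL ℝ c) ∘ F) z₀ = 0 := h2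
    rw [h3] at h1
    exact (congrArg (fun L : Plane →L[ℝ] ℝ => L h) h1).symm
  obtain ⟨e, R, hR, hes, he, hy⟩ := exists_local_graph hF hijk hz₀ hn hk
  have hcentre : coordProj i j (F z₀) = e z₀ := (he z₀).symm
  rw [hcentre] at hy
  set M := inner ℝ c (F z₀) with hM
  have hev : ∀ᶠ y in 𝓝 (e z₀), inner ℝ c (F (e.symm y)) ≤ M := by
    have := (e.continuousAt_symm (e.map_source hes)).tendsto
    rw [e.left_inv hes] at this
    exact this.eventually hmax
  obtain ⟨r, hr, hball⟩ := Metric.mem_nhds_iff.1 (inter_mem hev (ball_mem_nhds (e z₀) hR))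
  set v₁ : Plane → ℝ := fun y => F (e.symm y) k with hv₁
  -- The comparison surface is the plane where the linear function equals `M`, written as a graph;
  -- the sign of `c k` decides which graph lies above.
  set v₂ : Plane → ℝ := fun y => M / c k + (-(c i) / c k) * y 0 + (-(c j) / c k) * y 1 with hv₂
  have hval : ∀ y ∈ ball (e z₀) r,
      inner ℝ c (F (e.symm y)) = c i * y 0 + c j * y 1 + c k * v₁ y := by
    intro y hyr
    have h1 := coordProj_symm_apply he (hy y (hball hyr).2).1
    have h2 : F (e.symm y) i = y 0 := congrArg (fun p : Plane => p 0) h1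
    have h3 : F (e.symm y) j = y 1 := congrArg (fun p : Plane => p 1) h1
    rw [hijk.inner_eq, h2, h3]
  have hdiff : ∀ y, c k * (v₁ y - v₂ y) = c i * y 0 + c j * y 1 + c k * v₁ y - M := by
    intro y
    simp only [hv₂]
    field_simp
    ring
  have hs₁ : ∀ y ∈ ball (e z₀) r, ContDiffAt ℝ ∞ v₁ y := fun y hyr =>
    contDiffAt_height hF (hy y (hball hyr).2).2.1 (hy y (hball hyr).2).2.2.1 k
  have hs₂ : ∀ y ∈ ball (e z₀) r, ContDiffAt ℝ ∞ v₂ y := fun y _ =>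
    (contDiff_affine _ _ _).contDiffAt
  have hm₁ : ∀ y ∈ ball (e z₀) r, mse v₁ y = 0 := fun y hyr => (hy y (hball hyr).2).2.2.2
  have hm₂ : ∀ y ∈ ball (e z₀) r, mse v₂ y = 0 := fun y _ => mse_affine _ _ _ y
  have hle : ∀ y ∈ ball (e z₀) r, c k * (v₁ y - v₂ y) ≤ 0 := by
    intro y hyr
    rw [hdiff, ← hval y hyr]
    exact sub_nonpos.2 (hball hyr).1
  have hcb : e z₀ ∈ ball (e z₀) r := mem_ball_self hr
  have heq : v₁ (e z₀) = v₂ (e z₀) := by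
    have := hdiff (e z₀)
    rw [← hval _ hcb, e.left_inv hes, ← hM, sub_self] at this
    exact sub_eq_zero.1 ((mul_eq_zero.1 this).resolve_left hk)
  have hpre : IsPreconnected (ball (e z₀) r) := (convex_ball _ _).isPreconnected
  have hall : ∀ y ∈ ball (e z₀) r, v₁ y = v₂ y := by
    rcases lt_or_gt_of_ne hk with hneg | hpos
    · have := minimalGraph_touching isOpen_ball hpre hs₂ hs₁ hm₂ hm₁ (fun y hyr => by
        have := hle y hyr
        nlinarith) hcb heq.symm
      exact fun y hyr => (this y hyr).symm
    · exact minimalGraph_touching isOpen_ball hpre hs₁ hs₂ hm₁ hm₂ (fun y hyr => by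
        have := hle y hyr
        nlinarith) hcb heq
  filter_upwards [e.open_source.mem_nhds hes,
    (e.continuousAt hes).eventually (isOpen_ball.mem_nhds hcb)] with z hzs hzb
  have h1 := hval (e z) hzb
  have h2 := hdiff (e z)
  rw [← h1, hall _ hzb, sub_self, mul_zero, e.left_inv hzs] at h2
  linarith

/-- If the two tangent planes together spanned space, `(a, b) ↦ F₁ a - F₂ b` would be open near the
contact pair and would attain `s • w` for small positive `s`. Hence some nonzero vector is normal to
both, and both sheets are graphs in one common direction. -/
lemma exists_common_normal {F₁ F₂ : Plane → Space} {D₁ D₂ : Set Plane}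
    (h₁ : IsMinimalImmersionOn F₁ D₁) (h₂ : IsMinimalImmersionOn F₂ D₂) {z₁ z₂ : Plane}
    (hz₁ : z₁ ∈ D₁) (hz₂ : z₂ ∈ D₂) (heq : F₁ z₁ = F₂ z₂) {w : Space}
    (hdisj : ∀ s > (0 : ℝ), ∀ a ∈ D₁, ∀ b ∈ D₂, F₁ a ≠ F₂ b + s • w) :
    ∃ n : Space, n ≠ 0 ∧ (∀ h, inner ℝ n (fderiv ℝ F₁ z₁ h) = 0) ∧
      (∀ h, inner ℝ n (fderiv ℝ F₂ z₂ h) = 0) := by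
  set T : Plane × Plane →L[ℝ] Space := (fderiv ℝ F₁ z₁).comp (ContinuousLinearMap.fst ℝ _ _)
    - (fderiv ℝ F₂ z₂).comp (ContinuousLinearMap.snd ℝ _ _) with hT
  have hTapp : ∀ a b, T (a, b) = fderiv ℝ F₁ z₁ a - fderiv ℝ F₂ z₂ b := fun a b => rfl
  by_cases hr : LinearMap.range (T : Plane × Plane →ₗ[ℝ] Space) = ⊤
  · exfalso
    have hs₁ : HasStrictFDerivAt F₁ (fderiv ℝ F₁ z₁) z₁ :=
      (h₁.smooth z₁ hz₁).hasStrictFDerivAt (by simp)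
    have hs₂ : HasStrictFDerivAt F₂ (fderiv ℝ F₂ z₂) z₂ :=
      (h₂.smooth z₂ hz₂).hasStrictFDerivAt (by simp)
    have hΨ : HasStrictFDerivAt (fun p : Plane × Plane => F₁ p.1 - F₂ p.2) T (z₁, z₂) :=
      (HasStrictFDerivAt.comp (z₁, z₂) (g := F₁) (f := Prod.fst) hs₁ hasStrictFDerivAt_fst).sub
        (HasStrictFDerivAt.comp (z₁, z₂) (g := F₂) (f := Prod.snd) hs₂ hasStrictFDerivAt_snd)
    have hmap := hΨ.map_nhds_eq_of_surj hr
    have hD : D₁ ×ˢ D₂ ∈ 𝓝 (z₁, z₂) :=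
      prod_mem_nhds (h₁.isOpen.mem_nhds hz₁) (h₂.isOpen.mem_nhds hz₂)
    have himg : (fun p : Plane × Plane => F₁ p.1 - F₂ p.2) '' (D₁ ×ˢ D₂) ∈ 𝓝 (0 : Space) := by
      have := image_mem_map (m := fun p : Plane × Plane => F₁ p.1 - F₂ p.2) hD
      rw [hmap] at this
      simpa [heq] using this
    have htend : Tendsto (fun s : ℝ => s • w) (𝓝[>] 0) (𝓝 0) := by
      have : Tendsto (fun s : ℝ => s • w) (𝓝 0) (𝓝 ((0 : ℝ) • w)) :=
        (continuous_id.smul continuous_const).tendsto 0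
      rw [zero_smul] at this
      exact this.mono_left nhdsWithin_le_nhds
    obtain ⟨s, ⟨⟨a, b⟩, ⟨ha, hb⟩, hab⟩, hs⟩ :=
      ((htend.eventually himg).and self_mem_nhdsWithin).exists
    refine hdisj s hs a ha b hb ?_
    rw [← hab]
    simp
  · have hbot : (LinearMap.range (T : Plane × Plane →ₗ[ℝ] Space))ᗮ ≠ ⊥ := by
      rwa [Ne, Submodule.orthogonal_eq_bot_iff]
    obtain ⟨n, hn, hn0⟩ := Submodule.exists_mem_ne_zero_of_ne_bot hbot
    rw [Submodule.mem_orthogonal'] at hn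
    refine ⟨n, hn0, fun h => ?_, fun h => ?_⟩
    · have := hn (T (h, 0)) ⟨(h, 0), rfl⟩
      rwa [hTapp, map_zero, sub_zero] at this
    · have := hn (T (0, h)) ⟨(0, h), rfl⟩
      rwa [hTapp, map_zero, zero_sub, inner_neg_right, neg_eq_zero] at this

/-- If two minimal sheets meet at a point, but are disjoint as soon as one of them is translated
in the direction `w`, then they agree near that point. -/
theorem eventually_exists_eq_of_contact {F₁ F₂ : Plane → Space} {D₁ D₂ : Set Plane}
    (h₁ : IsMinimalImmersionOn F₁ D₁) (h₂ : IsMinimalImmersionOn F₂ D₂) {z₁ z₂ : Plane}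
    (hz₁ : z₁ ∈ D₁) (hz₂ : z₂ ∈ D₂) (heq : F₁ z₁ = F₂ z₂) {w : Space}
    (hdisj : ∀ s > (0 : ℝ), ∀ a ∈ D₁, ∀ b ∈ D₂, F₁ a ≠ F₂ b + s • w) :
    ∀ᶠ z in 𝓝 z₁, ∃ b ∈ D₂, F₁ z = F₂ b := by
  obtain ⟨n, hn0, hn₁, hn₂⟩ := exists_common_normal h₁ h₂ hz₁ hz₂ heq hdisj
  obtain ⟨k, hk⟩ : ∃ k, n k ≠ 0 := by
    by_contra! h
    exact hn0 (by ext l; exact h l)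
  obtain ⟨i, j, hijk⟩ := exists_coordTriple k
  obtain ⟨e₁, R₁, hR₁, hes₁, he₁, hy₁⟩ := exists_local_graph h₁ hijk hz₁ hn₁ hk
  obtain ⟨e₂, R₂, hR₂, hes₂, he₂, hy₂⟩ := exists_local_graph h₂ hijk hz₂ hn₂ hk
  rw [← heq] at hy₂
  set P := coordProj i j (F₁ z₁) with hP
  set R := min R₁ R₂ with hRdef
  have hR : 0 < R := lt_min hR₁ hR₂
  replace hy₁ := fun y (hy : y ∈ ball P R) => hy₁ y (ball_subset_ball (min_le_left _ _) hy)
  replace hy₂ := fun y (hy : y ∈ ball P R) => hy₂ y (ball_subset_ball (min_le_right _ _) hy)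
  set v₁ : Plane → ℝ := fun y => F₁ (e₁.symm y) k with hv₁
  set v₂ : Plane → ℝ := fun y => F₂ (e₂.symm y) k with hv₂
  have hs₁ : ∀ y ∈ ball P R, ContDiffAt ℝ ∞ v₁ y := fun y hy =>
    contDiffAt_height h₁ (hy₁ y hy).2.1 (hy₁ y hy).2.2.1 k
  have hs₂ : ∀ y ∈ ball P R, ContDiffAt ℝ ∞ v₂ y := fun y hy =>
    contDiffAt_height h₂ (hy₂ y hy).2.1 (hy₂ y hy).2.2.1 k
  have hm₁ : ∀ y ∈ ball P R, mse v₁ y = 0 := fun y hy => (hy₁ y hy).2.2.2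
  have hm₂ : ∀ y ∈ ball P R, mse v₂ y = 0 := fun y hy => (hy₂ y hy).2.2.2
  have hPb : P ∈ ball P R := mem_ball_self hR
  have heP₁ : e₁ z₁ = P := he₁ z₁
  have heP₂ : e₂ z₂ = P := by rw [he₂, ← heq]
  have hvP : v₁ P = v₂ P := by
    simp only [hv₁, hv₂]
    rw [← heP₁, e₁.left_inv hes₁, heP₁, ← heP₂, e₂.left_inv hes₂, heq]
  have hpre : IsPreconnected (ball P R) := (convex_ball _ _).isPreconnected
  set τ := coordProj i j w with hτ
  have hne : ∀ s > (0 : ℝ), ∀ y ∈ ball P R, y - s • τ ∈ ball P R →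
      v₁ y - s * w k - v₂ (y - s • τ) ≠ 0 := by
    intro s hs y hy hys h0
    refine hdisj s hs _ (hy₁ y hy).2.1 _ (hy₂ _ hys).2.1 (hijk.eq_of_coord_eq ?_ ?_)
    · rw [coordProj_add, coordProj_smul, coordProj_symm_apply he₁ (hy₁ y hy).1,
        coordProj_symm_apply he₂ (hy₂ _ hys).1, sub_add_cancel]
    · change v₁ y = v₂ (y - s • τ) + s * w k
      linarith
  -- If `v₁ - v₂` took both signs, so would the difference with a slightly translated `v₂`, and the
  -- intermediate value theorem would give a forbidden contact. The direction `w` need not be the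
  -- graph direction, so its component `τ` shifts the base point too.
  have hsign : (∀ y ∈ ball P R, v₁ y ≤ v₂ y) ∨ (∀ y ∈ ball P R, v₂ y ≤ v₁ y) := by
    by_contra! hcon
    obtain ⟨⟨a, ha, hva⟩, ⟨b, hb, hvb⟩⟩ := hcon
    have hev : ∀ y ∈ ball P R, Tendsto (fun s : ℝ => v₁ y - s * w k - v₂ (y - s • τ)) (𝓝[>] 0)
        (𝓝 (v₁ y - v₂ y)) := by
      intro y hy
      have h1 : ContinuousAt (fun s : ℝ => v₁ y - s * w k - v₂ (y - s • τ)) 0 := by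
        refine ContinuousAt.sub (by fun_prop) ?_
        refine ContinuousAt.comp (g := v₂) (f := fun s : ℝ => y - s • τ) ?_ (by fun_prop)
        simpa using (hs₂ y hy).continuousAt
      have h2 := h1.tendsto.mono_left (nhdsWithin_le_nhds (s := Set.Ioi 0))
      simpa using h2
    obtain ⟨r, hrR, har, hbr⟩ : ∃ r < R, dist a P < r ∧ dist b P < r := by
      obtain ⟨r, h1, h2⟩ := exists_between (max_lt (mem_ball.1 ha) (mem_ball.1 hb))
      exact ⟨r, h2, (le_max_left _ _).trans_lt h1, (le_max_right _ _).trans_lt h1⟩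
    have hsmall : ∀ᶠ s : ℝ in 𝓝[>] 0, ‖s • τ‖ < R - r := by
      have h1 : Tendsto (fun s : ℝ => ‖s • τ‖) (𝓝 0) (𝓝 ‖(0 : ℝ) • τ‖) :=
        Continuous.tendsto (by fun_prop) 0
      rw [zero_smul, norm_zero] at h1
      exact (h1.mono_left nhdsWithin_le_nhds).eventually (gt_mem_nhds (by linarith))
    obtain ⟨s, ⟨⟨hsa, hsb⟩, hss⟩, hs0⟩ := ((((hev a ha).eventually (lt_mem_nhds (sub_pos.2 hva))).and
      ((hev b hb).eventually (gt_mem_nhds (sub_neg.2 hvb)))).and hsmall |>.and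
      self_mem_nhdsWithin).exists
    have hshift : ∀ y ∈ ball P r, y - s • τ ∈ ball P R := by
      intro y hy
      rw [mem_ball] at hy ⊢
      have h1 : dist (y - s • τ) y = ‖s • τ‖ := by simp
      linarith [dist_triangle (y - s • τ) y P]
    have hsub : ball P r ⊆ ball P R := ball_subset_ball hrR.le
    have hcont : ContinuousOn (fun y => v₁ y - s * w k - v₂ (y - s • τ)) (ball P r) := by
      intro y hy
      refine ContinuousAt.continuousWithinAt ?_
      refine ((hs₁ y (hsub hy)).continuousAt.sub continuousAt_const).sub ?_
      exact ContinuousAt.comp (g := v₂) (f := fun y => y - s • τ)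
        (hs₂ _ (hshift y hy)).continuousAt (by fun_prop)
    obtain ⟨y, hy, hy0⟩ := (convex_ball P r).isPreconnected.intermediate_value hbr har hcont
      ⟨hsb.le, hsa.le⟩
    exact hne s hs0 y (hsub hy) (hshift y hy) hy0
  have hall : ∀ y ∈ ball P R, v₁ y = v₂ y := by
    rcases hsign with h | h
    · exact minimalGraph_touching isOpen_ball hpre hs₁ hs₂ hm₁ hm₂ h hPb hvP
    · have := minimalGraph_touching isOpen_ball hpre hs₂ hs₁ hm₂ hm₁ h hPb hvP.symm
      exact fun y hy => (this y hy).symm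
  filter_upwards [e₁.open_source.mem_nhds hes₁,
    (e₁.continuousAt hes₁).eventually (isOpen_ball.mem_nhds (heP₁ ▸ hPb))] with z hzs hzb
  rw [heP₁] at hzb
  refine ⟨e₂.symm (e₁ z), (hy₂ _ hzb).2.1, hijk.eq_of_coord_eq ?_ ?_⟩
  · rw [coordProj_symm_apply he₂ (hy₂ _ hzb).1, he₁]
  · have := hall _ hzb
    simp only [hv₁, hv₂] at this
    rwa [e₁.left_inv hzs] at this

/-! ### Projection of the boundary curve and of the open disk. -/

lemma continuous_horizontal : Continuous horizontal := (contDiff_coordProj 0 1).continuous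

lemma eq_of_horizontal_eq {p q : Space} (h : horizontal p = horizontal q) (h2 : p 2 = q 2) :
    p = q :=
  (show IsCoordTriple 0 1 2 by unfold IsCoordTriple; decide).eq_of_coord_eq h h2

lemma IsMinimalDisk.horizontal_mem {F : Plane → Space} {s : Set Space} {S : Set Plane}
    (hF : IsMinimalDisk F s) (hs : IsGraphicalOver s S) {z : Plane}
    (hz : z ∈ sphere (0 : Plane) 1) : horizontal (F z) ∈ S := by
  obtain ⟨h, rfl⟩ := hs
  exact (hF.boundary.mapsTo hz).1

lemma IsMinimalDisk.horizontal_injOn {F : Plane → Space} {s : Set Space} {S : Set Plane}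
    (hF : IsMinimalDisk F s) (hs : IsGraphicalOver s S) :
    Set.InjOn (fun z => horizontal (F z)) (sphere (0 : Plane) 1) := by
  obtain ⟨h, rfl⟩ := hs
  intro a ha b hb hab
  have h1 := (hF.boundary.mapsTo ha).2
  have h2 := (hF.boundary.mapsTo hb).2
  simp only at hab
  refine hF.boundary.injOn ha hb (eq_of_horizontal_eq hab ?_)
  rw [h1, h2, hab]

lemma sphere_plane_nonempty : (sphere (0 : Plane) 1).Nonempty :=
  ⟨EuclideanSpace.single 0 1, by simp⟩

lemma isPreconnected_sphere_plane : IsPreconnected (sphere (0 : Plane) 1) := by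
  refine isPreconnected_sphere ?_ 0 1
  rw [← Module.finrank_eq_rank]
  simp

lemma inner_plane (x y : Plane) : inner ℝ x y = x 0 * y 0 + x 1 * y 1 := by
  rw [PiLp.inner_apply, Fin.sum_univ_two]
  simp [mul_comm]

/-- A circle does not embed in a line. -/
lemma not_forall_inner_eq_of_injOn_sphere {g : Plane → Plane}
    (hg : ContinuousOn g (sphere 0 1)) (hinj : Set.InjOn g (sphere 0 1)) {c : Plane} (hc : c ≠ 0)
    (M : ℝ) : ¬ ∀ z ∈ sphere (0 : Plane) 1, inner ℝ c (g z) = M := by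
  intro hline
  set τ : Plane → ℝ := fun z => c 0 * g z 1 - c 1 * g z 0 with hτ
  have hneg : Set.MapsTo (fun z : Plane => -z) (sphere 0 1) (sphere 0 1) := fun z hz => by
    simpa using hz
  have hcoord : ∀ j, ContinuousOn (fun z => g z j) (sphere 0 1) := fun j =>
    (contDiff_coord j).continuous.comp_continuousOn hg
  have hτc : ContinuousOn τ (sphere 0 1) :=
    (continuousOn_const.mul (hcoord 1)).sub (continuousOn_const.mul (hcoord 0))
  -- An odd function on the circle has a zero, so two antipodal points have the same coordinate `τ`
  -- along the line, contradicting injectivity.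
  have hd : ContinuousOn (fun z => τ z - τ (-z)) (sphere 0 1) :=
    hτc.sub (hτc.comp continuous_neg.continuousOn hneg)
  obtain ⟨z, hz, hz0⟩ : ∃ z ∈ sphere (0 : Plane) 1, τ z - τ (-z) = 0 := by
    obtain ⟨p, hp⟩ := sphere_plane_nonempty
    have hp' := hneg hp
    rcases le_total (τ p - τ (-p)) 0 with h | h
    · exact isPreconnected_sphere_plane.intermediate_value hp hp' hd
        ⟨h, by simp only [neg_neg]; linarith⟩
    · exact isPreconnected_sphere_plane.intermediate_value hp' hp hd
        ⟨by simp only [neg_neg]; linarith, h⟩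
  have h1 : inner ℝ c (g z) = inner ℝ c (g (-z)) := by rw [hline z hz, hline _ (hneg hz)]
  rw [inner_plane, inner_plane] at h1
  have hc2 : 0 < c 0 ^ 2 + c 1 ^ 2 := by
    by_contra! h
    apply hc
    ext i
    fin_cases i
    · change c 0 = 0
      nlinarith [sq_nonneg (c 0), sq_nonneg (c 1)]
    · change c 1 = 0
      nlinarith [sq_nonneg (c 0), sq_nonneg (c 1)]
  simp only [hτ] at hz0
  have e0 : g z 0 = g (-z) 0 := by
    refine mul_left_cancel₀ hc2.ne' ?_
    linear_combination c 0 * h1 - c 1 * hz0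
  have e1 : g z 1 = g (-z) 1 := by
    refine mul_left_cancel₀ hc2.ne' ?_
    linear_combination c 1 * h1 + c 0 * hz0
  have : z = -z := hinj hz (hneg hz) (by ext i; fin_cases i <;> assumption)
  have hz00 : z = 0 := by
    have h2 : (2 : ℝ) • z = 0 := by rw [two_smul]; nth_rewrite 2 [this]; simp
    simpa using h2
  simp [hz00] at hz

/-- A convex plane set with empty interior lies in a line. -/
lemma exists_inner_eq_of_interior_eq_empty {Ω : Set Plane} (hΩ : Convex ℝ Ω)
    (hne : Ω.Nonempty) (hint : ¬ (interior Ω).Nonempty) :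
    ∃ c : Plane, c ≠ 0 ∧ ∃ M : ℝ, ∀ x ∈ closure Ω, inner ℝ c x = M := by
  rw [hΩ.interior_nonempty_iff_affineSpan_eq_top] at hint
  obtain ⟨x₀, hx₀⟩ := hne
  have hdir : (affineSpan ℝ Ω).direction ≠ ⊤ := by
    rwa [Ne, AffineSubspace.direction_eq_top_iff_of_nonempty
      ⟨x₀, subset_affineSpan ℝ Ω hx₀⟩]
  have hbot : ((affineSpan ℝ Ω).direction)ᗮ ≠ ⊥ := by
    rwa [Ne, Submodule.orthogonal_eq_bot_iff]
  obtain ⟨c, hc, hc0⟩ := Submodule.exists_mem_ne_zero_of_ne_bot hbot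
  rw [Submodule.mem_orthogonal'] at hc
  refine ⟨c, hc0, inner ℝ c x₀, fun x hx => ?_⟩
  have hclosed : IsClosed {x : Plane | inner ℝ c x = inner ℝ c x₀} :=
    isClosed_eq (by fun_prop) continuous_const
  refine closure_minimal (fun y hy => ?_) hclosed hx
  have := hc (y - x₀) (AffineSubspace.vsub_mem_direction (subset_affineSpan ℝ Ω hy)
    (subset_affineSpan ℝ Ω hx₀))
  rw [inner_sub_right, sub_eq_zero] at this
  exact this

lemma closedBall_diff_ball_plane {z : Plane} (hz : z ∈ closedBall (0 : Plane) 1)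
    (hz' : z ∉ ball (0 : Plane) 1) : z ∈ sphere (0 : Plane) 1 :=
  le_antisymm hz (not_lt.1 hz')

/-- A linear function on a minimal disk which attains its maximum in the interior is constant. -/
lemma IsMinimalDisk.inner_eq_of_isMaxOn {F : Plane → Space} {s : Set Space}
    (hF : IsMinimalDisk F s) {c : Space} {z₁ : Plane} (hz₁ : z₁ ∈ ball (0 : Plane) 1)
    (hmax : ∀ z ∈ closedBall (0 : Plane) 1, inner ℝ c (F z) ≤ inner ℝ c (F z₁)) :
    ∀ z ∈ closedBall (0 : Plane) 1, inner ℝ c (F z) = inner ℝ c (F z₁) := by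
  set M := inner ℝ c (F z₁) with hM
  have hf : ContinuousOn (fun z => inner ℝ c (F z)) (closedBall 0 1) :=
    (show Continuous fun p : Space => inner ℝ c p by fun_prop).comp_continuousOn hF.continuousOn
  have hball : ∀ z ∈ ball (0 : Plane) 1, inner ℝ c (F z) = M := by
    have hopen : IsOpen {z | z ∈ ball (0 : Plane) 1 ∧ inner ℝ c (F z) = M} := by
      rw [isOpen_iff_mem_nhds]
      rintro z ⟨hz, hzM⟩
      have hloc : IsLocalMax (fun z => inner ℝ c (F z)) z := by
        filter_upwards [isOpen_ball.mem_nhds hz] with y hy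
        rw [hzM]
        exact hmax y (ball_subset_closedBall hy)
      filter_upwards [isOpen_ball.mem_nhds hz,
        eventually_inner_eq_of_isLocalMax hF.isMinimalImmersionOn hz hloc] with y hy hy'
      exact ⟨hy, hy'.trans hzM⟩
    have hopen' : IsOpen (ball (0 : Plane) 1 ∩ (fun z => inner ℝ c (F z)) ⁻¹' Set.Iio M) :=
      (hf.mono ball_subset_closedBall).isOpen_inter_preimage isOpen_ball isOpen_Iio
    have hsub := (convex_ball (0 : Plane) 1).isPreconnected.subset_left_of_subset_union hopen hopen'
      ?_ ?_ ⟨z₁, hz₁, hz₁, rfl⟩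
    · exact fun z hz => (hsub hz).2
    · rw [Set.disjoint_left]
      rintro z ⟨-, h1⟩ ⟨-, h2⟩
      exact absurd h1 (ne_of_lt h2)
    · intro z hz
      rcases (hmax z (ball_subset_closedBall hz)).lt_or_eq with h | h
      · exact Or.inr ⟨hz, h⟩
      · exact Or.inl ⟨hz, h⟩
  intro z hz
  rw [← closure_ball (0 : Plane) one_ne_zero] at hz hf
  exact Set.EqOn.of_subset_closure (fun z hz => hball z hz) hf continuousOn_const
    subset_closure subset_rfl hz

/-- The interior of a minimal disk lies over the interior of the convex set bounded by the
projection of its boundary curve. -/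
theorem IsMinimalDisk.horizontal_mem_interior {Ω : Set Plane} (hΩ : Convex ℝ Ω) {σ : Set Space}
    (hgraph : IsGraphicalOver σ (frontier Ω)) {F : Plane → Space} (hF : IsMinimalDisk F σ)
    {z : Plane} (hz : z ∈ ball (0 : Plane) 1) : horizontal (F z) ∈ interior Ω := by
  have hhor : ContinuousOn (fun z => horizontal (F z)) (closedBall (0 : Plane) 1) :=
    continuous_horizontal.comp_continuousOn hF.continuousOn
  have hnoline : ∀ c : Plane, c ≠ 0 → ∀ M : ℝ, ¬ ∀ z ∈ sphere (0 : Plane) 1,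
      inner ℝ c (horizontal (F z)) = M := fun c hc M =>
    not_forall_inner_eq_of_injOn_sphere (hhor.mono sphere_subset_closedBall)
      (hF.horizontal_injOn hgraph) hc M
  have hint : (interior Ω).Nonempty := by
    by_contra hint
    have hne : Ω.Nonempty := by
      obtain ⟨p, hp⟩ := sphere_plane_nonempty
      exact closure_nonempty_iff.1 ⟨_, frontier_subset_closure (hF.horizontal_mem hgraph hp)⟩
    obtain ⟨c, hc, M, hM⟩ := exists_inner_eq_of_interior_eq_empty hΩ hne hint
    exact hnoline c hc M fun z hz =>
      hM _ (frontier_subset_closure (hF.horizontal_mem hgraph hz))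
  by_contra hzΩ
  -- A line through the projected point with the interior of Ω on one side gives a linear function
  -- whose boundary values do not exceed its value at `z`. Its maximum is thus attained inside, it
  -- is constant, and the projected circle would lie in a line.
  obtain ⟨f, hf⟩ := geometric_hahn_banach_open_point hΩ.interior isOpen_interior hzΩ
  set c : Plane := (InnerProductSpace.toDual ℝ Plane).symm f with hcdef
  have hcf : ∀ x, inner ℝ c x = f x := fun x => InnerProductSpace.toDual_symm_apply
  have hc : c ≠ 0 := by
    intro h0
    obtain ⟨x, hx⟩ := hint
    have := hf x hx
    rw [← hcf, ← hcf, h0] at this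
    simp at this
  have hbd : ∀ y ∈ sphere (0 : Plane) 1,
      inner ℝ c (horizontal (F y)) ≤ inner ℝ c (horizontal (F z)) := by
    intro y hy
    have hmem : horizontal (F y) ∈ closure (interior Ω) := by
      rw [hΩ.closure_interior_eq_closure_of_nonempty_interior hint]
      exact frontier_subset_closure (hF.horizontal_mem hgraph hy)
    have hclosed : IsClosed {x : Plane | inner ℝ c x ≤ inner ℝ c (horizontal (F z))} :=
      isClosed_le (by fun_prop) continuous_const
    refine closure_minimal (fun x hx => ?_) hclosed hmem
    change inner ℝ c x ≤ _
    rw [hcf, hcf]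
    exact (hf x hx).le
  set C : Space := !₂[c 0, c 1, 0] with hC
  have hCin : ∀ p, inner ℝ C p = inner ℝ c (horizontal p) := by
    intro p
    rw [inner_plane, PiLp.inner_apply, Fin.sum_univ_three]
    simp [hC, horizontal, mul_comm]
  have hCc : ContinuousOn (fun z => inner ℝ C (F z)) (closedBall (0 : Plane) 1) :=
    (show Continuous fun p : Space => inner ℝ C p by fun_prop).comp_continuousOn hF.continuousOn
  obtain ⟨z₀, hz₀, hmax⟩ := (isCompact_closedBall (0 : Plane) 1).exists_isMaxOn
    ⟨z, ball_subset_closedBall hz⟩ hCc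
  have hmax' : ∀ y ∈ closedBall (0 : Plane) 1, inner ℝ C (F y) ≤ inner ℝ C (F z₀) :=
    fun y hy => hmax hy
  obtain ⟨z₁, hz₁, hmax₁⟩ : ∃ z₁ ∈ ball (0 : Plane) 1,
      ∀ y ∈ closedBall (0 : Plane) 1, inner ℝ C (F y) ≤ inner ℝ C (F z₁) := by
    by_cases hb : z₀ ∈ ball (0 : Plane) 1
    · exact ⟨z₀, hb, hmax'⟩
    · refine ⟨z, hz, fun y hy => (hmax' y hy).trans ?_⟩
      rw [hCin, hCin]
      exact hbd z₀ (closedBall_diff_ball_plane hz₀ hb)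
  have hconst := hF.inner_eq_of_isMaxOn hz₁ hmax₁
  refine hnoline c hc (inner ℝ C (F z₁)) fun y hy => ?_
  rw [← hCin]
  exact hconst y (sphere_subset_closedBall hy)

/-! ### Height comparison by vertical translation. -/

/-- Of two minimal disks with the same boundary, neither has a point strictly above the other. -/
theorem IsMinimalDisk.height_le {Ω : Set Plane} (hΩ : Convex ℝ Ω) {σ : Set Space}
    (hgraph : IsGraphicalOver σ (frontier Ω)) {F₁ F₂ : Plane → Space} (h₁ : IsMinimalDisk F₁ σ)
    (h₂ : IsMinimalDisk F₂ σ) {a b : Plane} (ha : a ∈ closedBall (0 : Plane) 1)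
    (hb : b ∈ closedBall (0 : Plane) 1) (hab : horizontal (F₁ a) = horizontal (F₂ b)) :
    F₁ a 2 ≤ F₂ b 2 := by
  by_contra! hlt
  set B := closedBall (0 : Plane) 1 with hB
  have hBc : IsCompact B := isCompact_closedBall _ _
  -- contact is only possible over interior parameters
  have hinterior : ∀ a ∈ B, ∀ b ∈ B, horizontal (F₁ a) = horizontal (F₂ b) → F₂ b 2 < F₁ a 2 →
      a ∈ ball (0 : Plane) 1 ∧ b ∈ ball (0 : Plane) 1 := by
    intro a ha b hb hab hlt
    by_contra hcon
    have hfr : a ∈ sphere (0 : Plane) 1 ∧ b ∈ sphere (0 : Plane) 1 := by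
      by_cases ha' : a ∈ ball (0 : Plane) 1
      · have hb' : b ∈ sphere (0 : Plane) 1 :=
          closedBall_diff_ball_plane hb fun h => hcon ⟨ha', h⟩
        have h3 := h₁.horizontal_mem_interior hΩ hgraph ha'
        rw [hab] at h3
        exact absurd h3 (h₂.horizontal_mem hgraph hb').2
      · have ha'' := closedBall_diff_ball_plane ha ha'
        refine ⟨ha'', closedBall_diff_ball_plane hb fun hb' => ?_⟩
        have h3 := h₂.horizontal_mem_interior hΩ hgraph hb'
        rw [← hab] at h3
        exact (h₁.horizontal_mem hgraph ha'').2 h3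
    obtain ⟨h, rfl⟩ := hgraph
    have e1 := (h₁.boundary.mapsTo hfr.1).2
    have e2 := (h₂.boundary.mapsTo hfr.2).2
    rw [e1, e2, hab] at hlt
    exact lt_irrefl _ hlt
  have hc₁ : ContinuousOn (fun p : Plane × Plane => F₁ p.1) (B ×ˢ B) :=
    h₁.continuousOn.comp continuousOn_fst fun p hp => hp.1
  have hc₂ : ContinuousOn (fun p : Plane × Plane => F₂ p.2) (B ×ˢ B) :=
    h₂.continuousOn.comp continuousOn_snd fun p hp => hp.2
  have hcoord : Continuous fun p : Space => p 2 := by fun_prop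
  set K := (B ×ˢ B) ∩ (fun p : Plane × Plane => horizontal (F₁ p.1) - horizontal (F₂ p.2)) ⁻¹' {0}
    with hK
  have hKc : IsCompact K := by
    refine (hBc.prod hBc).of_isClosed_subset (ContinuousOn.preimage_isClosed_of_isClosed ?_
      (hBc.prod hBc).isClosed isClosed_singleton) Set.inter_subset_left
    exact (continuous_horizontal.comp_continuousOn hc₁).sub
      (continuous_horizontal.comp_continuousOn hc₂)
  have hKmem : ∀ a b, (a, b) ∈ K ↔ a ∈ B ∧ b ∈ B ∧ horizontal (F₁ a) = horizontal (F₂ b) := by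
    intro a b
    simp [hK, sub_eq_zero, and_assoc]
  have hdc : ContinuousOn (fun p : Plane × Plane => F₁ p.1 2 - F₂ p.2 2) (B ×ˢ B) :=
    (hcoord.comp_continuousOn hc₁).sub (hcoord.comp_continuousOn hc₂)
  obtain ⟨⟨a₀, b₀⟩, hab₀, hmax⟩ := hKc.exists_isMaxOn ⟨(a, b), (hKmem a b).2 ⟨ha, hb, hab⟩⟩
    (hdc.mono Set.inter_subset_left)
  -- The largest gap: raising the second disk by `T` leaves contact, raising it further leaves none,
  -- as the touching principle requires.
  set T := F₁ a₀ 2 - F₂ b₀ 2 with hT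
  have hmax' : ∀ a ∈ B, ∀ b ∈ B, horizontal (F₁ a) = horizontal (F₂ b) →
      F₁ a 2 - F₂ b 2 ≤ T := fun a ha b hb hab => hmax ((hKmem a b).2 ⟨ha, hb, hab⟩)
  have hTpos : 0 < T := by linarith [hmax' a ha b hb hab]
  obtain ⟨ha₀, hb₀, heq₀⟩ := (hKmem _ _).1 hab₀
  set w : Space := EuclideanSpace.single 2 1 with hw
  have hwh : ∀ (p : Space) (t : ℝ), horizontal (p + t • w) = horizontal p := by
    intro p t
    ext l
    fin_cases l <;> simp [horizontal, hw]
  have hw2 : ∀ (p : Space) (t : ℝ), (p + t • w) 2 = p 2 + t := by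
    intro p t; simp [hw]
  have hd₂ : IsMinimalImmersionOn (fun z => F₂ z + T • w) (ball 0 1) :=
    h₂.isMinimalImmersionOn.add_const _
  set Z := {a | a ∈ B ∧ ∃ b ∈ B, F₁ a = F₂ b + T • w} with hZ
  have hZint : ∀ a ∈ B, ∀ b ∈ B, F₁ a = F₂ b + T • w →
      a ∈ ball (0 : Plane) 1 ∧ b ∈ ball (0 : Plane) 1 := by
    intro a ha b hb h
    refine hinterior a ha b hb (by rw [h, hwh]) ?_
    rw [h, hw2]; linarith
  have hZball : Z ⊆ ball 0 1 := fun a ⟨ha, b, hb, h⟩ => (hZint a ha b hb h).1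
  have hZopen : IsOpen Z := by
    rw [isOpen_iff_mem_nhds]
    rintro a ⟨ha, b, hb, h⟩
    obtain ⟨ha', hb'⟩ := hZint a ha b hb h
    have := eventually_exists_eq_of_contact h₁.isMinimalImmersionOn hd₂ ha' hb' h (w := w) ?_
    · filter_upwards [this, isOpen_ball.mem_nhds ha'] with y ⟨b', hb', hy⟩ hyB
      exact ⟨ball_subset_closedBall hyB, b', ball_subset_closedBall hb', hy⟩
    · intro s hs x hx y hy hxy
      have h3 := hmax' x (ball_subset_closedBall hx) y (ball_subset_closedBall hy)
        (by rw [hxy, hwh, hwh])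
      rw [hxy, hw2, hw2] at h3
      linarith
  have hZcompact : IsCompact Z := by
    have himg : Z = Prod.fst '' ((B ×ˢ B) ∩
        (fun p : Plane × Plane => F₁ p.1 - (F₂ p.2 + T • w)) ⁻¹' {0}) := by
      ext a
      simp [hZ, sub_eq_zero, and_assoc]
    rw [himg]
    refine IsCompact.image ?_ continuous_fst
    exact (hBc.prod hBc).of_isClosed_subset (ContinuousOn.preimage_isClosed_of_isClosed
      (hc₁.sub (hc₂.add continuousOn_const)) (hBc.prod hBc).isClosed isClosed_singleton)
      Set.inter_subset_left
  have ha₀Z : a₀ ∈ Z := by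
    refine ⟨ha₀, b₀, hb₀, eq_of_horizontal_eq ?_ ?_⟩
    · rw [hwh, heq₀]
    · rw [hw2, hT]; ring
  -- The contact set is clopen in the connected plane, yet contained in the open unit disk.
  have huniv : Z = Set.univ := IsClopen.eq_univ ⟨hZcompact.isClosed, hZopen⟩ ⟨a₀, ha₀Z⟩
  obtain ⟨p, hp⟩ := sphere_plane_nonempty
  have hpZ : p ∈ Z := huniv ▸ Set.mem_univ p
  exact absurd (hZball hpZ) (by rw [mem_ball, mem_sphere.1 hp]; exact lt_irrefl _)

/-! ### Absence of vertical tangent planes. -/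

/-- With a horizontal normal the surface is a graph over a vertical coordinate plane. The height is
placed as the second base coordinate, so that `pd 1` differentiates vertically. -/
lemma exists_horizontal_coordTriple {n : Space} (hn : n ≠ 0) (hn2 : n 2 = 0) :
    ∃ i k : Fin 3, IsCoordTriple i 2 k ∧ n k ≠ 0 ∧
      ∀ p q : Space, p i = q i → p k = q k → horizontal p = horizontal q := by
  have hext : ∀ p q : Space, p 0 = q 0 → p 1 = q 1 → horizontal p = horizontal q := by
    intro p q h0 h1
    simp [horizontal, h0, h1]
  by_cases h0 : n 0 = 0
  · refine ⟨0, 1, by unfold IsCoordTriple; decide, fun h1 => hn ?_, hext⟩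
    ext l
    fin_cases l <;> assumption
  · exact ⟨1, 0, by unfold IsCoordTriple; decide, h0, fun p q h1 h0 => hext p q h0 h1⟩

lemma hasDerivAt_vertical {v : Plane → ℝ} {y : Plane} {t : ℝ}
    (hv : DifferentiableAt ℝ v (y + t • EuclideanSpace.single 1 1)) :
    HasDerivAt (fun t : ℝ => v (y + t • EuclideanSpace.single (1 : Fin 2) (1 : ℝ)))
      (pd 1 v (y + t • EuclideanSpace.single 1 1)) t := by
  have hline : HasDerivAt (fun t : ℝ => y + t • EuclideanSpace.single (1 : Fin 2) (1 : ℝ))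
      (EuclideanSpace.single 1 1) t := by
    simpa using ((hasDerivAt_id t).smul_const (EuclideanSpace.single (1 : Fin 2) (1 : ℝ))).const_add y
  exact hv.hasFDerivAt.comp_hasDerivAt t hline

lemma eventually_lt_of_pd_pos {v : Plane → ℝ} {y : Plane} (hv : DifferentiableAt ℝ v y)
    (hpos : 0 < pd 1 v y) :
    ∀ᶠ t : ℝ in 𝓝[>] 0, v y < v (y + t • EuclideanSpace.single 1 1) := by
  have h0 : y + (0 : ℝ) • EuclideanSpace.single (1 : Fin 2) (1 : ℝ) = y := by simp
  have hd := hasDerivAt_vertical (y := y) (t := 0) (by rwa [h0])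
  rw [h0] at hd
  have hs := (hasDerivAt_iff_tendsto_slope.1 hd).mono_left
    (nhdsWithin_mono (0 : ℝ) (s := Set.Ioi 0) fun t ht => ne_of_gt ht)
  filter_upwards [hs.eventually (lt_mem_nhds hpos), self_mem_nhdsWithin] with t ht ht0
  rw [slope_def_field, h0, sub_zero] at ht
  have := (div_pos_iff_of_pos_right (show (0 : ℝ) < t from ht0)).1 ht
  linarith

/-- If `v` is injective on the vertical chords of a disk, then `∂₁ v` does not change sign. -/
lemma pd_sign_of_injective_vertical {v : Plane → ℝ} {P : Plane} {R : ℝ}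
    (hv : ∀ y ∈ ball P R, ContDiffAt ℝ ∞ v y)
    (hinj : ∀ y ∈ ball P R, ∀ t > (0 : ℝ), y + t • EuclideanSpace.single 1 1 ∈ ball P R →
      v (y + t • EuclideanSpace.single 1 1) ≠ v y) :
    (∀ y ∈ ball P R, pd 1 v y ≤ 0) ∨ (∀ y ∈ ball P R, 0 ≤ pd 1 v y) := by
  by_contra! hcon
  obtain ⟨⟨a, ha, hva⟩, ⟨b, hb, hvb⟩⟩ := hcon
  set τ : Plane := EuclideanSpace.single 1 1 with hτ
  have hτn : ‖τ‖ = 1 := by simp [hτ]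
  obtain ⟨r, hrR, har, hbr⟩ : ∃ r < R, dist a P < r ∧ dist b P < r := by
    obtain ⟨r, h1, h2⟩ := exists_between (max_lt (mem_ball.1 ha) (mem_ball.1 hb))
    exact ⟨r, h2, (le_max_left _ _).trans_lt h1, (le_max_right _ _).trans_lt h1⟩
  have hb' : ∀ᶠ t : ℝ in 𝓝[>] 0, v (b + t • τ) < v b := by
    have := eventually_lt_of_pd_pos (v := fun y => - v y) (hv b hb).diffAt.neg
      (by rw [pd_neg]; linarith)
    filter_upwards [this] with t ht
    exact neg_lt_neg_iff.1 ht
  have hsmall : ∀ᶠ t : ℝ in 𝓝[>] 0, t < R - r :=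
    nhdsWithin_le_nhds (gt_mem_nhds (by linarith))
  -- One small step `t` raises `v` at `a` and lowers it at `b`; in between, some chord of length `t`
  -- has equal end values.
  obtain ⟨t, ⟨⟨hta, htb⟩, hts⟩, ht0⟩ := (((eventually_lt_of_pd_pos (hv a ha).diffAt hva).and
    hb').and hsmall |>.and self_mem_nhdsWithin).exists
  have ht0' : 0 < t := ht0
  have hshift : ∀ y ∈ ball P r, y + t • τ ∈ ball P R := by
    intro y hy
    rw [mem_ball] at hy ⊢
    have h1 : dist (y + t • τ) y = t := by simp [norm_smul, hτn, abs_of_pos ht0']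
    linarith [dist_triangle (y + t • τ) y P]
  have hsub : ball P r ⊆ ball P R := ball_subset_ball hrR.le
  have hcont : ContinuousOn (fun y => v (y + t • τ) - v y) (ball P r) := by
    intro y hy
    refine ContinuousAt.continuousWithinAt ?_
    refine ContinuousAt.sub ?_ (hv y (hsub hy)).continuousAt
    exact ContinuousAt.comp (g := v) (f := fun y => y + t • τ)
      (hv _ (hshift y hy)).continuousAt (by fun_prop)
  obtain ⟨y, hy, hy0⟩ := (convex_ball P r).isPreconnected.intermediate_value hbr har hcont
    ⟨(sub_neg.2 htb).le, (sub_pos.2 hta).le⟩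
  exact hinj y (hsub hy) t ht0' (hshift y hy) (sub_eq_zero.1 hy0)

/-- A minimal immersion whose height is determined by its horizontal projection has no vertical
tangent planes. -/
theorem normal_vertical_ne_zero {F : Plane → Space} {D : Set Plane}
    (hF : IsMinimalImmersionOn F D)
    (hheight : ∀ a ∈ D, ∀ b ∈ D, horizontal (F a) = horizontal (F b) → F a 2 = F b 2)
    {z₀ : Plane} (hz₀ : z₀ ∈ D) {n : Space} (hn0 : n ≠ 0)
    (hn : ∀ h, inner ℝ n (fderiv ℝ F z₀ h) = 0) : n 2 ≠ 0 := by
  intro hn2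
  obtain ⟨i, k, hijk, hk, hhor⟩ := exists_horizontal_coordTriple hn0 hn2
  obtain ⟨e, R, hR, hes, he, hy⟩ := exists_local_graph hF hijk hz₀ hn hk
  set P := coordProj i 2 (F z₀) with hP
  set v : Plane → ℝ := fun y => F (e.symm y) k with hv
  have heP : e z₀ = P := he z₀
  have hPb : P ∈ ball P R := mem_ball_self hR
  have hs : ∀ y ∈ ball P R, ContDiffAt ℝ ∞ v y := fun y hyb =>
    contDiffAt_height hF (hy y hyb).2.1 (hy y hyb).2.2.1 k
  have hm : ∀ y ∈ ball P R, mse v y = 0 := fun y hyb => (hy y hyb).2.2.2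
  have hi : ∀ y ∈ ball P R, F (e.symm y) i = y 0 := fun y hyb =>
    congrArg (fun p : Plane => p 0) (coordProj_symm_apply he (hy y hyb).1)
  have h2 : ∀ y ∈ ball P R, F (e.symm y) 2 = y 1 := fun y hyb =>
    congrArg (fun p : Plane => p 1) (coordProj_symm_apply he (hy y hyb).1)
  have hinj : ∀ y ∈ ball P R, ∀ t > (0 : ℝ), y + t • EuclideanSpace.single 1 1 ∈ ball P R →
      v (y + t • EuclideanSpace.single 1 1) ≠ v y := by
    intro y hyb t ht hytb hvv
    have h3 := hheight _ (hy _ hytb).2.1 _ (hy y hyb).2.1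
      (hhor _ _ (by rw [hi _ hytb, hi y hyb]; simp) hvv)
    rw [h2 _ hytb, h2 y hyb] at h3
    simp at h3
    exact ht.ne' h3
  -- Since `n 2 = 0`, the vanishing vertical derivative of `⟨n, F⟩` reduces to `n k * pd 1 v P`.
  have hzero : pd 1 v P = 0 := by
    have hval : (fun y => inner ℝ n (F (e.symm y))) =ᶠ[𝓝 P] fun y => n i * y 0 + n k * v y := by
      filter_upwards [isOpen_ball.mem_nhds hPb] with y hyb
      rw [hijk.inner_eq, hi y hyb, hn2, zero_mul, add_zero]
    have hlhs : pd 1 (fun y => inner ℝ n (F (e.symm y))) P = 0 := by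
      have hsymm : e.symm P = z₀ := by rw [← heP, e.left_inv hes]
      have hFd : HasFDerivAt F (fderiv ℝ F z₀) (e.symm P) := by
        rw [hsymm]; exact ((hF.smooth z₀ hz₀).differentiableAt (by simp)).hasFDerivAt
      have hed := ((hy P hPb).2.2.1.differentiableAt (by simp)).hasFDerivAt
      have := ((innerSL ℝ n).hasFDerivAt.comp P (hFd.comp P hed)).fderiv
      refine (congrArg (fun L : Plane →L[ℝ] ℝ => L (EuclideanSpace.single 1 1)) this).trans ?_
      exact hn _
    have hvd := (hs P hPb).diffAt
    have h0 : DifferentiableAt ℝ (fun y : Plane => y 0) P := (contDiff_coord 0).contDiffAt.diffAt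
    rw [pd_congr hval, pd_add ((differentiableAt_const _).fun_mul h0)
      ((differentiableAt_const _).fun_mul hvd), pd_mul (differentiableAt_const _) h0,
      pd_mul (differentiableAt_const _) hvd, pd_const, pd_const, pd_coord] at hlhs
    simpa [hk] using hlhs
  have hall := minimalGraph_pd_eq_zero isOpen_ball (convex_ball P R).isPreconnected hs hm
    (pd_sign_of_injective_vertical hs hinj) hPb hzero
  have hseg : ∀ t ∈ Set.Icc 0 (R / 2), P + t • EuclideanSpace.single 1 1 ∈ ball P R := by
    intro t ht
    have : dist (P + t • EuclideanSpace.single (1 : Fin 2) (1 : ℝ)) P = t := by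
      simp [norm_smul, abs_of_nonneg ht.1]
    rw [mem_ball, this]
    linarith [ht.2]
  have hder : ∀ t ∈ Set.Icc 0 (R / 2), HasDerivAt
      (fun t : ℝ => v (P + t • EuclideanSpace.single (1 : Fin 2) (1 : ℝ))) 0 t := by
    intro t ht
    have := hasDerivAt_vertical (hs _ (hseg t ht)).diffAt
    rwa [hall _ (hseg t ht)] at this
  have hR2 : (0 : ℝ) < R / 2 := by linarith
  have hconst := constant_of_has_deriv_right_zero
    (fun t ht => (hder t ht).continuousAt.continuousWithinAt)
    (fun t ht => (hder t ⟨ht.1, ht.2.le⟩).hasDerivWithinAt) (R / 2) ⟨hR2.le, le_rfl⟩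
  refine hinj P hPb (R / 2) hR2 (hseg _ ⟨hR2.le, le_rfl⟩) ?_
  simpa using hconst

lemma exists_normal {F : Plane → Space} (z : Plane) :
    ∃ n : Space, n ≠ 0 ∧ ∀ h, inner ℝ n (fderiv ℝ F z h) = 0 := by
  have hbot : (LinearMap.range (fderiv ℝ F z : Plane →ₗ[ℝ] Space))ᗮ ≠ ⊥ := by
    rw [Ne, Submodule.orthogonal_eq_bot_iff]
    intro htop
    have h1 := LinearMap.finrank_range_le (fderiv ℝ F z : Plane →ₗ[ℝ] Space)
    rw [htop, finrank_top] at h1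
    simp at h1
  obtain ⟨n, hn, hn0⟩ := Submodule.exists_mem_ne_zero_of_ne_bot hbot
  rw [Submodule.mem_orthogonal'] at hn
  exact ⟨n, hn0, fun h => hn _ ⟨h, rfl⟩⟩

/-! ### Injectivity by covering theory. -/

/-- A continuous map of the closed disk to the plane which is a local homeomorphism on the open
disk, and maps the open disk into a convex open set and its boundary circle out of it, is injective
on the open disk. -/
theorem injOn_ball_of_isLocalHomeomorphOn {G : Plane → Plane}
    (hG : ContinuousOn G (closedBall 0 1)) (hloc : IsLocalHomeomorphOn G (ball 0 1))
    {U : Set Plane} (hU : IsOpen U) (hUc : Convex ℝ U)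
    (hin : Set.MapsTo G (ball 0 1) U) (hout : ∀ z ∈ sphere (0 : Plane) 1, G z ∉ U) :
    Set.InjOn G (ball 0 1) := by
  intro z₁ hz₁ z₂ hz₂ h12
  set B := closedBall (0 : Plane) 1 with hB
  have hsub : ball (0 : Plane) 1 ⊆ B := ball_subset_closedBall
  have : CompactSpace B := isCompact_iff_compactSpace.1 (isCompact_closedBall _ _)
  set f : B → Plane := fun z => G z with hf
  have hfc : Continuous f := continuousOn_iff_continuous_domRestrict.1 hG
  have hι : IsOpenEmbedding (Set.inclusion hsub) := by
    refine ⟨IsEmbedding.inclusion hsub, ?_⟩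
    rw [Set.range_inclusion]
    exact isOpen_ball.preimage continuous_subtype_val
  have hfloc : IsLocalHomeomorphOn f (Set.inclusion hsub '' Set.univ) := by
    refine IsLocalHomeomorphOn.of_comp_right ?_ hι.isLocalHomeomorph.isLocalHomeomorphOn
    change IsLocalHomeomorphOn (G ∘ (Subtype.val : ball (0 : Plane) 1 → Plane)) Set.univ
    exact hloc.comp isOpen_ball.isOpenEmbedding_subtypeVal.isLocalHomeomorph.isLocalHomeomorphOn
      fun z _ => z.2
  -- The closed disk is compact and fibres over `U` avoid the boundary circle, so a local
  -- homeomorphism there is a covering.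
  have hcov : IsCoveringMapOn f U := by
    intro x hx
    refine IsEvenlyCovered.of_openPartialHomeomorph hfc fun e he => ?_
    have heB : (e : Plane) ∈ ball (0 : Plane) 1 := by
      by_contra hcon
      have he' : G e = x := he
      exact hout e (closedBall_diff_ball_plane e.2 hcon) (he' ▸ hx)
    obtain ⟨φ, hφ, hφe⟩ := hfloc e ⟨⟨e, heB⟩, trivial, rfl⟩
    exact ⟨φ, hφ, hφe.symm⟩
  have : ContractibleSpace U := hUc.contractibleSpace ⟨_, hin hz₁⟩
  have : LocallyPathConnectedSpace U := hU.locallyPathConnectedSpace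
  have : ContractibleSpace (ball (0 : Plane) 1) :=
    (convex_ball (0 : Plane) 1).contractibleSpace ⟨z₁, hz₁⟩
  have : LocallyPathConnectedSpace (ball (0 : Plane) 1) := isOpen_ball.locallyPathConnectedSpace
  obtain ⟨S, ⟨hS₁, hS⟩, -⟩ := hcov.existsUnique_continuousMap_lifts
    (⟨Subtype.val, continuous_subtype_val⟩ : C(U, Plane)) (a₀ := ⟨G z₁, hin hz₁⟩)
    (e₀ := ⟨z₁, hsub hz₁⟩) rfl (fun a => a.2)
  have hgc : Continuous fun z : ball (0 : Plane) 1 => (⟨G z, hin z.2⟩ : U) :=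
    (continuousOn_iff_continuous_domRestrict.1 (hG.mono hsub)).subtype_mk _
  set Γ : C(ball (0 : Plane) 1, U) := ⟨_, hgc⟩ with hΓ
  have huniq := hcov.existsUnique_continuousMap_lifts
    (⟨fun z => G z, continuousOn_iff_continuous_domRestrict.1 (hG.mono hsub)⟩ :
      C(ball (0 : Plane) 1, Plane)) (a₀ := ⟨z₁, hz₁⟩)
    (e₀ := ⟨z₁, hsub hz₁⟩) rfl (fun a => hin a.2)
  -- `S` is the section over `U` through `z₁`. Both `S ∘ G` and the inclusion lift `G` and agree at
  -- `z₁`, so they coincide, and `G z` determines `z`.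
  have e1 := huniq.unique (y₁ := ⟨Set.inclusion hsub, hι.continuous⟩) (y₂ := S.comp Γ) ⟨rfl, rfl⟩
    ⟨hS₁, by
      funext z
      exact congrFun hS (Γ z)⟩
  have e3 := congrArg (fun c : C(ball (0 : Plane) 1, B) => ((c ⟨z₂, hz₂⟩ : B) : Plane)) e1
  have hΓ2 : Γ ⟨z₂, hz₂⟩ = ⟨G z₁, hin hz₁⟩ := Subtype.ext h12.symm
  change z₂ = ((S (Γ ⟨z₂, hz₂⟩) : B) : Plane) at e3
  rw [hΓ2, hS₁] at e3
  exact e3.symm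

/-! ### The projection as a homeomorphism, and the graph function. -/

section Rado

variable {Ω : Set Plane} {σ : Set Space} {F : Plane → Space}

/-- Two minimal disks with the same boundary have the same height over every point. -/
lemma IsMinimalDisk.height_eq (hΩ : Convex ℝ Ω) (hgraph : IsGraphicalOver σ (frontier Ω))
    {F₁ F₂ : Plane → Space} (h₁ : IsMinimalDisk F₁ σ) (h₂ : IsMinimalDisk F₂ σ) {a b : Plane}
    (ha : a ∈ closedBall (0 : Plane) 1) (hb : b ∈ closedBall (0 : Plane) 1)
    (hab : horizontal (F₁ a) = horizontal (F₂ b)) : F₁ a 2 = F₂ b 2 :=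
  le_antisymm (h₁.height_le hΩ hgraph h₂ ha hb hab) (h₂.height_le hΩ hgraph h₁ hb ha hab.symm)

lemma IsMinimalDisk.exists_horizontal_graph (hΩ : Convex ℝ Ω)
    (hgraph : IsGraphicalOver σ (frontier Ω)) (hF : IsMinimalDisk F σ) {z : Plane}
    (hz : z ∈ ball (0 : Plane) 1) :
    ∃ (e : OpenPartialHomeomorph Plane Plane) (R : ℝ), 0 < R ∧ z ∈ e.source ∧
      (∀ z, e z = horizontal (F z)) ∧ ∀ y ∈ ball (horizontal (F z)) R,
        y ∈ e.target ∧ e.symm y ∈ ball (0 : Plane) 1 ∧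
          ContDiffAt ℝ ∞ (fun y => F (e.symm y) 2) y := by
  obtain ⟨n, hn0, hn⟩ := exists_normal (F := F) z
  -- The disk is compared with itself: equal projections force equal heights before injectivity is
  -- known.
  have hn2 := normal_vertical_ne_zero hF.isMinimalImmersionOn (fun a ha b hb hab =>
    IsMinimalDisk.height_eq hΩ hgraph hF hF (ball_subset_closedBall ha)
      (ball_subset_closedBall hb) hab) hz hn0 hn
  obtain ⟨e, R, hR, hes, he, hy⟩ := exists_local_graph hF.isMinimalImmersionOn
    (show IsCoordTriple 0 1 2 by unfold IsCoordTriple; decide) hz hn hn2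
  exact ⟨e, R, hR, hes, he, fun y hyb => ⟨(hy y hyb).1, (hy y hyb).2.1,
    contDiffAt_height hF.isMinimalImmersionOn (hy y hyb).2.1 (hy y hyb).2.2.1 2⟩⟩

lemma IsMinimalDisk.continuousOn_horizontal (hF : IsMinimalDisk F σ) :
    ContinuousOn (fun z => horizontal (F z)) (closedBall (0 : Plane) 1) :=
  continuous_horizontal.comp_continuousOn hF.continuousOn

/-- Interior parameters land in the interior of Ω and boundary ones on its frontier, so only
collisions of the same kind remain. Coverings exclude the first kind, the graph property of σ the
second. -/
lemma IsMinimalDisk.horizontal_injOn_closedBall (hΩ : Convex ℝ Ω)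
    (hgraph : IsGraphicalOver σ (frontier Ω)) (hF : IsMinimalDisk F σ) :
    Set.InjOn (fun z => horizontal (F z)) (closedBall (0 : Plane) 1) := by
  have hin : Set.MapsTo (fun z => horizontal (F z)) (ball (0 : Plane) 1) (interior Ω) :=
    fun z hz => hF.horizontal_mem_interior hΩ hgraph hz
  have hout : ∀ z ∈ sphere (0 : Plane) 1, horizontal (F z) ∉ interior Ω := fun z hz =>
    (hF.horizontal_mem hgraph hz).2
  have hloc : IsLocalHomeomorphOn (fun z => horizontal (F z)) (ball 0 1) := by
    refine IsLocalHomeomorphOn.mk _ _ fun z hz => ?_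
    obtain ⟨e, R, hR, hes, he, -⟩ := hF.exists_horizontal_graph hΩ hgraph hz
    exact ⟨e, hes, fun y _ => (he y).symm⟩
  have hball := injOn_ball_of_isLocalHomeomorphOn hF.continuousOn_horizontal hloc isOpen_interior
    hΩ.interior hin hout
  intro a ha b hb hab
  by_cases ha' : a ∈ ball (0 : Plane) 1
  · by_cases hb' : b ∈ ball (0 : Plane) 1
    · exact hball ha' hb' hab
    · exact absurd (hin ha')
        (by rw [hab]; exact hout b (closedBall_diff_ball_plane hb hb'))
  · by_cases hb' : b ∈ ball (0 : Plane) 1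
    · exact absurd (hin hb')
        (by rw [← hab]; exact hout a (closedBall_diff_ball_plane ha ha'))
    · exact hF.horizontal_injOn hgraph (closedBall_diff_ball_plane ha ha')
        (closedBall_diff_ball_plane hb hb') hab

/-- The image is open by the local inverses and relatively closed in the interior of Ω, because the
closed disk has compact image and its boundary circle misses that interior. Convexity supplies
connectedness. -/
lemma IsMinimalDisk.horizontal_image_ball (hΩ : Convex ℝ Ω)
    (hgraph : IsGraphicalOver σ (frontier Ω)) (hF : IsMinimalDisk F σ) :
    (fun z => horizontal (F z)) '' ball (0 : Plane) 1 = interior Ω := by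
  refine Set.Subset.antisymm ?_ ?_
  · rintro _ ⟨z, hz, rfl⟩
    exact hF.horizontal_mem_interior hΩ hgraph hz
  have hopen : IsOpen ((fun z => horizontal (F z)) '' ball (0 : Plane) 1) := by
    rw [isOpen_iff_mem_nhds]
    rintro _ ⟨z, hz, rfl⟩
    obtain ⟨e, R, hR, hes, he, hy⟩ := hF.exists_horizontal_graph hΩ hgraph hz
    filter_upwards [ball_mem_nhds _ hR] with y hyb
    exact ⟨e.symm y, (hy y hyb).2.1, by
      change horizontal (F (e.symm y)) = y
      rw [← he, e.right_inv (hy y hyb).1]⟩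
  have hclosed : IsClosed ((fun z => horizontal (F z)) '' closedBall (0 : Plane) 1) :=
    ((isCompact_closedBall _ _).image_of_continuousOn hF.continuousOn_horizontal).isClosed
  have h0 : (0 : Plane) ∈ ball (0 : Plane) 1 := mem_ball_self one_pos
  refine hΩ.interior.isPreconnected.subset_left_of_subset_union hopen hclosed.isOpen_compl ?_ ?_
    ⟨_, hF.horizontal_mem_interior hΩ hgraph h0, ⟨0, h0, rfl⟩⟩
  · rw [Set.disjoint_left]
    rintro _ ⟨z, hz, rfl⟩ hcon
    exact hcon ⟨z, ball_subset_closedBall hz, rfl⟩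
  · intro x hx
    by_cases hxc : x ∈ (fun z => horizontal (F z)) '' closedBall (0 : Plane) 1
    · obtain ⟨z, hz, rfl⟩ := hxc
      refine Or.inl ⟨z, ?_, rfl⟩
      by_contra hz'
      exact (hF.horizontal_mem hgraph (closedBall_diff_ball_plane hz hz')).2 hx
    · exact Or.inr hxc

lemma IsMinimalDisk.horizontal_image_closedBall (hΩ : Convex ℝ Ω)
    (hgraph : IsGraphicalOver σ (frontier Ω)) (hF : IsMinimalDisk F σ) :
    (fun z => horizontal (F z)) '' closedBall (0 : Plane) 1 = closure Ω := by
  have hball := hF.horizontal_image_ball hΩ hgraph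
  refine Set.Subset.antisymm ?_ ?_
  · rintro _ ⟨z, hz, rfl⟩
    by_cases hz' : z ∈ ball (0 : Plane) 1
    · exact interior_subset_closure (hF.horizontal_mem_interior hΩ hgraph hz')
    · exact frontier_subset_closure
        (hF.horizontal_mem hgraph (closedBall_diff_ball_plane hz hz'))
  · intro x hx
    by_cases hxi : x ∈ interior Ω
    · rw [← hball] at hxi
      exact Set.image_mono ball_subset_closedBall hxi
    · obtain ⟨h, rfl⟩ := hgraph
      have hxh : horizontal !₂[x 0, x 1, h x] = x := by
        ext l; fin_cases l <;> simp [horizontal]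
      obtain ⟨z, hz, hzx⟩ := hF.boundary.surjOn (a := !₂[x 0, x 1, h x])
        (show _ ∧ _ by rw [hxh]; exact ⟨⟨hx, hxi⟩, by simp⟩)
      refine ⟨z, sphere_subset_closedBall hz, ?_⟩
      simp only [hzx, hxh]

/-- A minimal disk with boundary graphical over the boundary of a convex set is a graph. -/
theorem IsMinimalDisk.exists_graph (hΩ : Convex ℝ Ω) (hgraph : IsGraphicalOver σ (frontier Ω))
    (hF : IsMinimalDisk F σ) :
    ∃ u : Plane → ℝ, ContinuousOn u (closure Ω) ∧ ContDiffOn ℝ ∞ u (interior Ω) ∧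
      F '' closedBall 0 1 = graphOver u (closure Ω) ∧
      F '' ball 0 1 = graphOver u (interior Ω) := by
  have hex : ∀ x, ∃ t : ℝ, ∀ z ∈ closedBall (0 : Plane) 1, horizontal (F z) = x → F z 2 = t := by
    intro x
    by_cases hx : ∃ z ∈ closedBall (0 : Plane) 1, horizontal (F z) = x
    · obtain ⟨z, hz, hzx⟩ := hx
      exact ⟨F z 2, fun y hy hyx =>
        IsMinimalDisk.height_eq hΩ hgraph hF hF hy hz (hyx.trans hzx.symm)⟩
    · push Not at hx
      -- The value off the projected disk is arbitrary.
      exact ⟨0, fun z hz hzx => absurd hzx (hx z hz)⟩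
  choose u hu using hex
  have hu' : ∀ z ∈ closedBall (0 : Plane) 1, F z 2 = u (horizontal (F z)) := fun z hz =>
    hu _ z hz rfl
  have himg := hF.horizontal_image_closedBall hΩ hgraph
  have hball := hF.horizontal_image_ball hΩ hgraph
  have hgr : ∀ D ⊆ closedBall (0 : Plane) 1,
      F '' D = graphOver u ((fun z => horizontal (F z)) '' D) := by
    intro D hD
    ext p
    constructor
    · rintro ⟨z, hz, rfl⟩
      exact ⟨⟨z, hz, rfl⟩, hu' z (hD hz)⟩
    · rintro ⟨⟨z, hz, hzp⟩, hp⟩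
      refine ⟨z, hz, eq_of_horizontal_eq hzp ?_⟩
      rw [hp, hu' z (hD hz)]
      exact congrArg u hzp
  refine ⟨u, ?_, ?_, ?_, ?_⟩
  -- Preimages of closed sets under `u` are projections of compact sets of parameters.
  · rw [continuousOn_iff_isClosed]
    intro t ht
    have hc2 : ContinuousOn (fun z => F z 2) (closedBall (0 : Plane) 1) :=
      (show Continuous fun p : Space => p 2 by fun_prop).comp_continuousOn hF.continuousOn
    refine ⟨(fun z => horizontal (F z)) '' (closedBall (0 : Plane) 1 ∩ (fun z => F z 2) ⁻¹' t),
      ?_, ?_⟩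
    · refine IsCompact.isClosed (IsCompact.image_of_continuousOn ?_
        (hF.continuousOn_horizontal.mono Set.inter_subset_left))
      exact (isCompact_closedBall _ _).of_isClosed_subset
        (hc2.preimage_isClosed_of_isClosed isClosed_closedBall ht) Set.inter_subset_left
    · ext x
      constructor
      · rintro ⟨hxt, hx⟩
        refine ⟨?_, hx⟩
        rw [← himg] at hx
        obtain ⟨z, hz, rfl⟩ := hx
        refine ⟨z, ⟨hz, ?_⟩, rfl⟩
        change F z 2 ∈ t
        rw [hu' z hz]
        exact hxt
      · rintro ⟨⟨z, ⟨hz, hzt⟩, rfl⟩, hx⟩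
        refine ⟨?_, hx⟩
        change u (horizontal (F z)) ∈ t
        rw [← hu' z hz]
        exact hzt
  · intro x hx
    rw [← hball] at hx
    obtain ⟨z, hz, rfl⟩ := hx
    obtain ⟨e, R, hR, hes, he, hy⟩ := hF.exists_horizontal_graph hΩ hgraph hz
    refine ContDiffAt.contDiffWithinAt ?_
    refine (hy _ (mem_ball_self hR)).2.2.congr_of_eventuallyEq ?_
    filter_upwards [ball_mem_nhds _ hR] with y hyb
    refine (hu y _ (ball_subset_closedBall (hy y hyb).2.1) ?_).symm
    rw [← he, e.right_inv (hy y hyb).1]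
  · rw [hgr _ subset_rfl, himg]
  · rw [hgr _ ball_subset_closedBall, hball]

lemma IsMinimalDisk.image_subset (hΩ : Convex ℝ Ω) (hgraph : IsGraphicalOver σ (frontier Ω))
    {F₁ F₂ : Plane → Space} (h₁ : IsMinimalDisk F₁ σ) (h₂ : IsMinimalDisk F₂ σ) :
    F₁ '' closedBall 0 1 ⊆ F₂ '' closedBall 0 1 := by
  rintro _ ⟨a, ha, rfl⟩
  have hmem : horizontal (F₁ a) ∈ (fun z => horizontal (F₂ z)) '' closedBall (0 : Plane) 1 := by
    rw [h₂.horizontal_image_closedBall hΩ hgraph, ← h₁.horizontal_image_closedBall hΩ hgraph]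
    exact ⟨a, ha, rfl⟩
  obtain ⟨b, hb, hab⟩ := hmem
  exact ⟨b, hb, eq_of_horizontal_eq hab (IsMinimalDisk.height_eq hΩ hgraph h₂ h₁ hb ha hab)⟩

end Rado

end RadoTheorem

theorem mainTheorem2 (Ω : Set Plane) (hΩ : Convex ℝ Ω)
    (σ : Set Space) (hσ : IsSimpleClosedCurve σ) (hgraph : IsGraphicalOver σ (frontier Ω)) :
    (∀ F : Plane → Space, IsMinimalDisk F σ →
      Set.InjOn F (Metric.closedBall 0 1) ∧
      ∃ u : Plane → ℝ,
        ContinuousOn u (closure Ω) ∧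
        ContDiffOn ℝ ∞ u (interior Ω) ∧
        F '' Metric.closedBall 0 1 = graphOver u (closure Ω) ∧
        F '' Metric.ball 0 1 = graphOver u (interior Ω)) ∧
    (∀ F₁ F₂ : Plane → Space, IsMinimalDisk F₁ σ → IsMinimalDisk F₂ σ →
      F₁ '' Metric.closedBall 0 1 = F₂ '' Metric.closedBall 0 1) := by
  refine ⟨fun F hF => ⟨fun a ha b hb hab => ?_, hF.exists_graph hΩ hgraph⟩,
    fun F₁ F₂ h₁ h₂ => Set.Subset.antisymm (h₁.image_subset hΩ hgraph h₂)
      (h₂.image_subset hΩ hgraph h₁)⟩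
  exact hF.horizontal_injOn_closedBall hΩ hgraph ha hb (congrArg horizontal hab)
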